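/- **Setting.** Let $A=\{0,1,2\}$, $B=\{0,1\}$, $B^0=B\sqcup\{0_B\}$, $I^0=\{0,1\}$. A graded $4$-nilpotent semigroup of type $(3,2,1,1)$ on $A\sqcup B\sqcup\{1\}\sqcup\{0\}$ is given by maps $\mu:A\times A\to B^0$, $\phi:A\times B^0\to I^0$, $\psi:B^0\times A\to I^0$ with $\phi(x,0_B)=\psi(0_B,x)=0$ for which $\tau(x,y,z):=\phi(x,\mu(y,z))=\psi(\mu(x,y),z)$. A *position* is a quadruple $p=(m,l,r,t)$ of $\{0,1\}$-valued tensors (masks) for $\mu,\phi,\psi,\tau$; a zero entry means that the corresponding value is excluded. A *column* of a mask is its restriction to one choice of the arguments of the function, and it is *determined* if it has exactly one entry $1$. **Process.** One round performs the following three operations in this order. 1. Put $t(x,y,z,i)=0$ unless there is $q\in B^0$ with $m(y,z,q)=l(x,q,i)=1$ and there is $q\in B^0$ with $m(x,y,q)=r(q,z,i)=1$. 2. Put $r(q,z,i)=0$ if there are $x,y$ such that the column $m(x,y,\cdot)$ is determined with value $q$ and $t(x,y,z,i)=0$; put $l(x,q,i)=0$ if there are $y,z$ such that $m(y,z,\cdot)$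 is determined with value $q$ and $t(x,y,z,i)=0$. 3. Put $m(x,y,q)=0$ if there are $z,i$ with $r(q,z,i)=0=t(x,y,z,1-i)$, or $z,i$ with $l(z,q,i)=0=t(z,x,y,1-i)$. The position $\mathrm{process}(p)$ is obtained from $p$ by repeating this round until nothing changes. **Filter.** A position is *impossible* if at least one of the following holds: - some column of $m,l,r$ or $t$ has no entry $1$; - (profile filter) two distinct $q,q'\in B^0$ satisfy: for all $x\in A$ the columns $l(x,q,\cdot)$, $l(x,q',\cdot)$ are determined and equal, and so are $r(q,x,\cdot)$, $r(q',x,\cdot)$; or all columns of $m$ are determined and two distinct $x,x'\in A$ satisfy: $m(x,y,\cdot)=m(x',y,\cdot)$ and $m(y,x,\cdot)=m(y,x',\cdot)$ for all $y\in A$, and for all $q\in B^0$ the columns $l(x,q,\cdot)$, $l(x',q,\cdot)$ are determined and equal, and so are $r(q,x,\cdot)$, $r(q,x',\cdot)$; - (half-ones filter) the number of columns of $r$ that are determined with value $1$ is larger than the number of columns of $l$ that are determined with value $1$. It is *done* if it is not impossible and all columns of $m$ are determined, and *active* if it is neither impossible nor done. **Proofs.** At an active position $p$ a *cut* may be made at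 any $(x,y)\in A\times A$ for which $m(x,y,\cdot)$ has at least two entries $1$. It generates, for each $z$ with $m(x,y,z)=1$, the position $\mathrm{process}(p_z)$, where $p_z$ is $p$ with the column $m(x,y,\cdot)$ replaced by the one whose only entry $1$ is at $z$. A *classification proof* for $p$ is a finite tree of positions with root $p$ in which each non-leaf (*passive*) node is active and its children are the positions generated by some cut, and in which all leaves are impossible or done. Its *size* is the number of its passive nodes. **Instances.** Up to permutations of rows and columns there are $13$ matrices in $\{0,1\}^{3\times 2}$, represented by the following $\phi_\sigma|_{A\times B}$, $\sigma=0,\dots,12$ (the rows are separated by semicolons): $[00;00;00]$, $[01;00;00]$, $[01;01;00]$, $[01;01;01]$, $[11;00;00]$, $[10;01;00]$, $[11;01;00]$, $[10;01;01]$, $[11;01;01]$, $[11;11;00]$, $[11;10;01]$, $[11;11;01]$, $[11;11;11]$. The root position of the instance $\sigma$ has as $l$ the mask that determines $\phi_\sigma$, has $r(0_B,x,1)=0$ for all $x\in A$, and all other entries of $m,r,t$ are $1$. **Theorem.** 1. The minimal size $\nu_{\min}(\sigma)$ of a classification proof for the root position of the instance $\sigma$ is | $\sigma$ | 0 | 1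 | 2 | 3 | 4 | 5 | 6 | 7 | 8 | 9 | 10 | 11 | 12 | |---|---|---|---|---|---|---|---|---|---|---|---|---|---| | $\nu_{\min}(\sigma)$ | 9 | 21 | 23 | 37 | 11 | 5 | 3 | 5 | 3 | 11 | 3 | 3 | 17 | 2. The minimal total size of a family of classification proofs, one for each of the $13$ instances, is $151$. 3. There is one real-valued score function $N_2(p;(x,y))$ on positions $p$ and locations $(x,y)\in A\times A$ such that for each $\sigma$ there is a classification proof in which every cut has the smallest score among the cuts available at its position, and every such proof has size $\nu_{\min}(\sigma)$ (however ties are broken); so these proofs together attain the total $151$. -/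

import Mathlib

/-!
Classification by cuts of graded 4-nilpotent semigroups `A ⊔ B ⊔ {1} ⊔ {0}` of type `(a, b, 1, 1)`.

Conventions: `A = Fin a`; `B⁰ = Fin (b + 1)`, whose zero `0_B` is `Fin.last b`, so that `B` consists
of the elements `0, …, b - 1`; `I⁰ = Bool`, with `0_I = false` and `1 = true`.
A mask of a function is a Boolean tensor: the entry at `(x, y, z)` is `true` if the value at `(x, y)`
might be `z`, and `false` if this value is excluded.
-/

namespace NilpotentCuts

/-- A position: masks for `μ : A × A → B⁰`, `φ : A × B⁰ → I⁰`, `ψ : B⁰ × A → I⁰` and for the triple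
product `τ : A × A × A → I⁰`. -/
structure Position (a b : ℕ) where
  m : Fin a → Fin a → Fin (b + 1) → Bool
  l : Fin a → Fin (b + 1) → Bool → Bool
  r : Fin (b + 1) → Fin a → Bool → Bool
  t : Fin a → Fin a → Fin a → Bool → Bool

/-- The number of values which a column of a mask still allows. -/
def stat {Z : Type} [Fintype Z] (c : Z → Bool) : ℕ :=
  (Finset.univ.filter fun z => c z = true).card

namespace Position

variable {a b : ℕ}

/-! ### The process function -/

/-- Deductions on the triple product: `x·y·z = i` is excluded unless some allowed value `q` of `y·z`
allows `x·q = i` and some allowed value `q` of `x·y` allows `q·z = i`. -/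
def ternaryStep (p : Position a b) : Position a b :=
  { p with
    t := fun x y z i => p.t x y z i
      && decide (∃ q, p.m y z q = true ∧ p.l x q i = true)
      && decide (∃ q, p.m x y q = true ∧ p.r q z i = true) }

/-- Deductions on the left and right multiplications: if `y·z` has `q` as its only allowed value and
`x·y·z = i` is excluded, then `x·q = i` is excluded; similarly on the other side. -/
def leftRightStep (p : Position a b) : Position a b :=
  { p with
    l := fun x q i => p.l x q i
      && decide (∀ y z, p.m y z q = true → stat (p.m y z) = 1 → p.t x y z i = true)
    r := fun q z i => p.r q z i
      && decide (∀ x y, p.m x y q = true → stat (p.m x y) = 1 → p.t x y z i = true) }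

/-- Deductions on the product: `x·y = q` is excluded if for some `z` and `i` the mask of `ψ` excludes
`q·z = i` and the mask of `τ` excludes `x·y·z = 1 - i`; similarly with a left factor. -/
def prodStep (p : Position a b) : Position a b :=
  { p with
    m := fun x y q => p.m x y q
      && decide (∀ z i, p.l z q i = true ∨ p.t z x y (!i) = true)
      && decide (∀ z i, p.r q z i = true ∨ p.t x y z (!i) = true) }

/-- One round of deductions. -/
def step (p : Position a b) : Position a b :=
  p.ternaryStep.leftRightStep.prodStep

/-- The total number of entries equal to `1` in the four masks. -/
def ones (p : Position a b) : ℕ :=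
  (∑ x, ∑ y, stat (p.m x y)) + (∑ x, ∑ q, stat (p.l x q)) + (∑ q, ∑ x, stat (p.r q x))
    + ∑ x, ∑ y, ∑ z, stat (p.t x y z)

/-- Rounds of deductions, repeated until nothing changes any more. Each round that changes something
deletes at least one entry, so `p.ones` rounds suffice (see `step_process` below). -/
def process (p : Position a b) : Position a b :=
  step^[p.ones] p

/-! ### The filter -/

/-- Some column of one of the masks allows no value at all. -/
def HasEmptyColumn (p : Position a b) : Prop :=
  (∃ x y, stat (p.m x y) = 0) ∨ (∃ x q, stat (p.l x q) = 0) ∨ (∃ q x, stat (p.r q x) = 0) ∨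
    (∃ x y z, stat (p.t x y z) = 0)

/-- The mask of `μ` determines `μ`. -/
def ProdDone (p : Position a b) : Prop :=
  ∀ x y, stat (p.m x y) = 1

/-- Two columns determine a value, and the same one. -/
def SameValue {Z : Type} [Fintype Z] (c c' : Z → Bool) : Prop :=
  stat c = 1 ∧ ∀ z, c z = c' z

/-- Two distinct elements of `B⁰` have the same multiplication profile: the position determines their
products with all `x` on both sides, and these are equal. -/
def SameProfileB (p : Position a b) : Prop :=
  ∃ q q' : Fin (b + 1), q ≠ q' ∧
    ∀ x, SameValue (p.l x q) (p.l x q') ∧ SameValue (p.r q x) (p.r q' x)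

/-- Two distinct elements of `A` have the same multiplication profile: `μ` is determined, the products
of the two elements with the elements of `B⁰` are determined, and all their products are equal. -/
def SameProfileA (p : Position a b) : Prop :=
  p.ProdDone ∧ ∃ x x' : Fin a, x ≠ x' ∧
    (∀ y, SameValue (p.m x y) (p.m x' y) ∧ SameValue (p.m y x) (p.m y x')) ∧
    (∀ q, SameValue (p.l x q) (p.l x' q) ∧ SameValue (p.r q x) (p.r q x'))

/-- The number of entries of `φ` which are determined and nonzero; `φ` itself is determined at the
positions that matter, so that this is the number of nonzero entries of `φ`. -/
def leftOnes (p : Position a b) : ℕ :=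
  (Finset.univ.filter fun e : Fin a × Fin (b + 1) =>
    p.l e.1 e.2 true = true ∧ p.l e.1 e.2 false = false).card

/-- The number of entries of `ψ` which are determined and nonzero. -/
def rightOnes (p : Position a b) : ℕ :=
  (Finset.univ.filter fun e : Fin (b + 1) × Fin a =>
    p.r e.1 e.2 true = true ∧ p.r e.1 e.2 false = false).card

/-- A position is impossible if a column is empty, or by the profile filter, or by the half-ones
filter. -/
def Impossible (p : Position a b) : Prop :=
  p.HasEmptyColumn ∨ (p.SameProfileB ∨ p.SameProfileA) ∨ p.leftOnes < p.rightOnes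

/-- A position is done if it is not impossible and `μ` is determined. -/
def Done (p : Position a b) : Prop :=
  ¬ p.Impossible ∧ p.ProdDone

/-- A position is active if it is neither impossible nor done. -/
def Active (p : Position a b) : Prop :=
  ¬ p.Impossible ∧ ¬ p.Done

/-! ### Cuts and proof trees -/

/-- A cut may be made at `(x, y)` if at least two values of `x·y` are still allowed. -/
def Available (p : Position a b) (x y : Fin a) : Prop :=
  2 ≤ stat (p.m x y)

/-- The position generated by the cut at `(x, y)` for the value `z`: the column of the mask of `μ` at
`(x, y)` is replaced by the one that allows `z` only, and the result is processed. -/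
def cut (p : Position a b) (x y : Fin a) (z : Fin (b + 1)) : Position a b :=
  process { p with
    m := fun x' y' z' => if x' = x ∧ y' = y then decide (z' = z) else p.m x' y' z' }

/-- The initial position of a matrix `φ : A × B → I⁰`: the mask of `φ` is the one which determines
`φ`, with `x·0_B = 0_I`, and there is no restriction on `μ`, `ψ` and `τ` except `0_B·x = 0_I`. -/
def initial (φ : Fin a → Fin b → Bool) : Position a b where
  m := fun _ _ _ => true
  l := fun x q i => decide (i = Fin.snoc (α := fun _ => Bool) (φ x) false q)
  r := fun q _ i => decide (q = Fin.last b → i = false)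
  t := fun _ _ _ _ => true

end Position

/-- Partial proof trees with a given position at the root. A passive node has an active position, a
cut at an available location, and one subtree for each value that is allowed there. -/
inductive ProofTree {a b : ℕ} : Position a b → Type
  | leaf (p : Position a b) : ProofTree p
  | passive (p : Position a b) (active : p.Active) (x y : Fin a) (available : p.Available x y)
      (below : ∀ z : Fin (b + 1), p.m x y z = true → ProofTree (p.cut x y z)) : ProofTree p

namespace ProofTree

variable {a b : ℕ}

/-- A proof tree is complete if no leaf is active, that is, if all leaves are done or impossible. -/
def Complete {p : Position a b} : ProofTree p → Prop
  | leaf p => ¬ p.Active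
  | passive _ _ _ _ _ below => ∀ z h, (below z h).Complete

/-- The number of passive nodes. -/
def numPassive {p : Position a b} : ProofTree p → ℕ
  | leaf _ => 0
  | passive p _ x y _ below =>
      1 + ∑ z, if h : p.m x y z = true then (below z h).numPassive else 0

/-- Every cut of the tree has the smallest score among the cuts available at its position, for a
score function `N₂` on pairs of a position and a location. -/
def Follows (N₂ : Position a b → Fin a → Fin a → ℝ) {p : Position a b} : ProofTree p → Prop
  | leaf _ => True
  | passive p _ x y _ below =>
      (∀ x' y', p.Available x' y' → N₂ p x y ≤ N₂ p x' y') ∧ ∀ z h, (below z h).Follows N₂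

end ProofTree

/-- The possible numbers of passive nodes of a complete proof tree with root position `p`. -/
def proofSizes {a b : ℕ} (p : Position a b) : Set ℕ :=
  {n | ∃ T : ProofTree p, T.Complete ∧ T.numPassive = n}

/-! ### The thirteen instances for `(a, b) = (3, 2)` -/

/-- The left multiplication matrices `L(σ)`, with rows indexed by `A` and columns by `B`. -/
def instanceMatrix : Fin 13 → Matrix (Fin 3) (Fin 2) ℕ :=
  ![!![0, 0; 0, 0; 0, 0], !![0, 1; 0, 0; 0, 0], !![0, 1; 0, 1; 0, 0], !![0, 1; 0, 1; 0, 1],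
    !![1, 1; 0, 0; 0, 0], !![1, 0; 0, 1; 0, 0], !![1, 1; 0, 1; 0, 0], !![1, 0; 0, 1; 0, 1],
    !![1, 1; 0, 1; 0, 1], !![1, 1; 1, 1; 0, 0], !![1, 1; 1, 0; 0, 1], !![1, 1; 1, 1; 0, 1],
    !![1, 1; 1, 1; 1, 1]]

/-- The function `φ : A × B → I⁰` of the instance `σ`. -/
def instancePhi (σ : Fin 13) : Fin 3 → Fin 2 → Bool :=
  fun x q => decide (instanceMatrix σ x q = 1)

/-- The root position of the instance `σ`. -/
def root (σ : Fin 13) : Position 3 2 :=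
  Position.initial (instancePhi σ)

/-- The minimal numbers of passive nodes. -/
def nuMin : Fin 13 → ℕ :=
  ![9, 21, 23, 37, 11, 5, 3, 5, 3, 11, 3, 3, 17]

/-! ### Checks on the definitions -/

/-- The thirteen instances represent each orbit of `3 × 2` Boolean matrices under permutations of rows
and columns exactly once. -/
theorem existsUnique_instance (φ : Fin 3 → Fin 2 → Bool) :
    ∃! σ : Fin 13, ∃ g : Equiv.Perm (Fin 3), ∃ h : Equiv.Perm (Fin 2),
      ∀ x q, φ (g x) (h q) = instancePhi σ x q := by
  have hex : ∀ φ : Fin 3 → Fin 2 → Bool, ∃ σ : Fin 13, ∃ g : Equiv.Perm (Fin 3),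
      ∃ h : Equiv.Perm (Fin 2), ∀ x q, φ (g x) (h q) = instancePhi σ x q := by
    decide +kernel
  have huniq : ∀ σ σ' : Fin 13, ∀ g : Equiv.Perm (Fin 3), ∀ h : Equiv.Perm (Fin 2),
      (∀ x q, instancePhi σ (g x) (h q) = instancePhi σ' x q) → σ = σ' := by
    decide +kernel
  obtain ⟨σ, g, h, e⟩ := hex φ
  refine ⟨σ, ⟨g, h, e⟩, ?_⟩
  rintro σ' ⟨g', h', e'⟩
  refine huniq σ' σ (g'⁻¹ * g) (h'⁻¹ * h) fun x q => ?_
  rw [← e', ← e]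
  simp

theorem stat_le {Z : Type} [Fintype Z] {c d : Z → Bool}
    (h : ∀ z, c z = true → d z = true) : stat c ≤ stat d :=
  Finset.card_le_card fun z hz => by
    simp only [Finset.mem_filter, Finset.mem_univ, true_and] at hz ⊢
    exact h z hz

theorem eq_of_stat_eq {Z : Type} [Fintype Z] {c d : Z → Bool}
    (h : ∀ z, c z = true → d z = true) (e : stat c = stat d) : c = d := by
  have hs : (Finset.univ.filter fun z => c z = true) = Finset.univ.filter fun z => d z = true :=
    Finset.eq_of_subset_of_card_le (fun z hz => by
      simp only [Finset.mem_filter, Finset.mem_univ, true_and] at hz ⊢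
      exact h z hz) e.ge
  funext z
  have hz : c z = true ↔ d z = true := by
    simpa using congrArg (fun s => z ∈ s) hs
  exact Bool.eq_iff_iff.2 hz

namespace Position

variable {a b : ℕ}

theorem step_m_le (p : Position a b) (x y : Fin a) (z : Fin (b + 1)) :
    (step p).m x y z = true → p.m x y z = true := by
  simp +contextual [step, prodStep, leftRightStep, ternaryStep]

theorem step_l_le (p : Position a b) (x : Fin a) (q : Fin (b + 1)) (i : Bool) :
    (step p).l x q i = true → p.l x q i = true := by
  simp +contextual [step, prodStep, leftRightStep, ternaryStep]

theorem step_r_le (p : Position a b) (q : Fin (b + 1)) (x : Fin a) (i : Bool) :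
    (step p).r q x i = true → p.r q x i = true := by
  simp +contextual [step, prodStep, leftRightStep, ternaryStep]

theorem step_t_le (p : Position a b) (x y z : Fin a) (i : Bool) :
    (step p).t x y z i = true → p.t x y z i = true := by
  simp +contextual [step, prodStep, leftRightStep, ternaryStep]

theorem ones_step_lt (p : Position a b) (h : step p ≠ p) : (step p).ones < p.ones := by
  have hm := fun x y => stat_le (step_m_le p x y)
  have hl := fun x q => stat_le (step_l_le p x q)
  have hr := fun q x => stat_le (step_r_le p q x)
  have ht := fun x y z => stat_le (step_t_le p x y z)
  have hm1 := fun x => Finset.sum_le_sum fun y (_ : y ∈ Finset.univ) => hm x y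
  have hl1 := fun x => Finset.sum_le_sum fun q (_ : q ∈ Finset.univ) => hl x q
  have hr1 := fun q => Finset.sum_le_sum fun x (_ : x ∈ Finset.univ) => hr q x
  have ht1 := fun x y => Finset.sum_le_sum fun z (_ : z ∈ Finset.univ) => ht x y z
  have ht2 := fun x => Finset.sum_le_sum fun y (_ : y ∈ Finset.univ) => ht1 x y
  have hm3 := Finset.sum_le_sum fun x (_ : x ∈ Finset.univ) => hm1 x
  have hl3 := Finset.sum_le_sum fun x (_ : x ∈ Finset.univ) => hl1 x
  have hr3 := Finset.sum_le_sum fun q (_ : q ∈ Finset.univ) => hr1 q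
  have ht3 := Finset.sum_le_sum fun x (_ : x ∈ Finset.univ) => ht2 x
  by_contra hlt
  unfold ones at hlt
  apply h
  have em := (Finset.sum_eq_sum_iff_of_le (s := Finset.univ) fun x _ => hm1 x).1 (by omega)
  have el := (Finset.sum_eq_sum_iff_of_le (s := Finset.univ) fun x _ => hl1 x).1 (by omega)
  have er := (Finset.sum_eq_sum_iff_of_le (s := Finset.univ) fun x _ => hr1 x).1 (by omega)
  have et := (Finset.sum_eq_sum_iff_of_le (s := Finset.univ) fun x _ => ht2 x).1 (by omega)
  have Em : (step p).m = p.m := by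
    funext x y
    exact eq_of_stat_eq (step_m_le p x y)
      ((Finset.sum_eq_sum_iff_of_le fun y _ => hm x y).1 (em x (Finset.mem_univ x)) y
        (Finset.mem_univ y))
  have El : (step p).l = p.l := by
    funext x y
    exact eq_of_stat_eq (step_l_le p x y)
      ((Finset.sum_eq_sum_iff_of_le fun y _ => hl x y).1 (el x (Finset.mem_univ x)) y
        (Finset.mem_univ y))
  have Er : (step p).r = p.r := by
    funext x y
    exact eq_of_stat_eq (step_r_le p x y)
      ((Finset.sum_eq_sum_iff_of_le fun y _ => hr x y).1 (er x (Finset.mem_univ x)) y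
        (Finset.mem_univ y))
  have Et : (step p).t = p.t := by
    funext x y z
    have h1 := (Finset.sum_eq_sum_iff_of_le fun y _ => ht1 x y).1 (et x (Finset.mem_univ x)) y
      (Finset.mem_univ y)
    exact eq_of_stat_eq (step_t_le p x y z)
      ((Finset.sum_eq_sum_iff_of_le fun z _ => ht x y z).1 h1 z (Finset.mem_univ z))
  generalize step p = s at Em El Er Et
  cases s; cases p
  simp_all

/-- The position `process p` is stable under further rounds of deductions. -/
theorem step_process (p : Position a b) : step (process p) = process p := by
  have key : ∀ n : ℕ, step (step^[n] p) = step^[n] p ∨ (step^[n] p).ones + n ≤ p.ones := by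
    intro n
    induction n with
    | zero => exact Or.inr le_rfl
    | succ n ih =>
      rw [Function.iterate_succ_apply']
      by_cases hfix : step (step^[n] p) = step^[n] p
      · exact Or.inl (by rw [hfix, hfix])
      · have h1 := ones_step_lt _ hfix
        rcases ih with ih | ih
        · exact absurd ih hfix
        · exact Or.inr (by omega)
  rcases key p.ones with h | h
  · exact h
  · by_contra hne
    have h1 := ones_step_lt _ hne
    unfold process at h1
    omega

end Position

end NilpotentCuts

/-!
**Lower bounds.** Call a position open if a round does not change it and it is neither impossible
nor done. A round is monotone above open positions: a column that is determined at the larger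
position is determined with the same value at the smaller one (`Stable.le_step`). Hence a position
above an open one with the same mask of `φ` is active, so that a proof for it begins with a cut
(`Stable.active_of_le`; fixing the mask of `φ` takes care of the half-ones filter, which is not
monotone in it). The position generated by this cut for the value `z` is above each open position
below the given one that is compatible with the value. A lower bound for the proofs at all positions
above an open position `q` therefore follows from lower bounds of the same kind at smaller open
positions, by a minimum over the cuts available at `q` (`Position.Open.atLeast`). It suffices to
give, for each instance, a list of open positions for which bounds are derived one after the other,
the last ones giving `ν_min σ` at the root. An open position is specified by a mask of `μ` from
which it arises from the root by processing. It is the largest stable position below the root within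
this mask, and such positions can be compared by means of their masks of `μ` alone
(`Packed.describes_toBlock`).

**Upper bounds.** A proof is specified by its cuts in depth-first order (`Packed.play`).

**Evaluation.** Both checks are evaluated in the kernel. The four masks of a position are packed
into natural numbers, as tensors with five indices each, so that a round of deductions amounts to a
few bitwise operations and shifts (`Packed.Rep.step`). The bounds found so far are the blocks of one
number, with which a mask is compared in a single sequence of bitwise operations
(`Packed.boundSize`). Such a search need not be trusted, since the block that it finds is checked.
The positions and the cuts for the thirteen instances were found by computer search.

**Score function.** The score of a cut is the minimal size of a proof which begins with it. A proof
that follows this score is minimal, by induction, since each of its cuts is the first cut of some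
minimal proof (`numPassive_of_follows`).
-/

namespace NilpotentCuts

variable {a b : ℕ}

/-! ### The order of positions -/

namespace Position

/-- `p.Le q`: every value excluded by `q` is excluded by `p`. -/
structure Le (p q : Position a b) : Prop where
  m : ∀ x y z, p.m x y z = true → q.m x y z = true
  l : ∀ x s i, p.l x s i = true → q.l x s i = true
  r : ∀ s x i, p.r s x i = true → q.r s x i = true
  t : ∀ x y z i, p.t x y z i = true → q.t x y z i = true

theorem Le.refl (p : Position a b) : p.Le p :=
  ⟨fun _ _ _ h => h, fun _ _ _ h => h, fun _ _ _ h => h, fun _ _ _ _ h => h⟩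

theorem step_le (p : Position a b) : (step p).Le p :=
  ⟨step_m_le p, step_l_le p, step_r_le p, step_t_le p⟩

theorem Le.trans {p q s : Position a b} (h : p.Le q) (h' : q.Le s) : p.Le s :=
  ⟨fun x y z e => h'.m x y z (h.m x y z e), fun x y z e => h'.l x y z (h.l x y z e),
    fun x y z e => h'.r x y z (h.r x y z e), fun x y z i e => h'.t x y z i (h.t x y z i e)⟩

theorem iterate_step_le (p : Position a b) (n : ℕ) : (step^[n] p).Le p := by
  induction n with
  | zero => exact Le.refl p
  | succ n ih =>
    rw [Function.iterate_succ_apply']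
    exact (step_le _).trans ih

theorem process_le (p : Position a b) : (process p).Le p :=
  iterate_step_le p _

/-- A position obtained by finitely many rounds is `process p` as soon as one more round does not
change it. -/
theorem process_eq_of_iterate {p : Position a b} {n : ℕ} (h : step (step^[n] p) = step^[n] p) :
    process p = step^[n] p := by
  have fix : ∀ {s : Position a b}, step s = s → ∀ k : ℕ, step^[k] s = s := fun hs k =>
    Function.iterate_fixed hs k
  rcases le_total n p.ones with hn | hn
  · obtain ⟨k, hk⟩ := Nat.exists_eq_add_of_le' hn
    rw [process, hk, Function.iterate_add_apply, fix h]
  · obtain ⟨k, rfl⟩ := Nat.exists_eq_add_of_le' hn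
    rw [Function.iterate_add_apply]
    exact (fix (step_process p) k).symm

end Position

/-! ### Columns -/

section Columns

variable {Z : Type} [Fintype Z]

theorem stat_pos {c : Z → Bool} : stat c ≠ 0 ↔ ∃ z, c z = true := by
  simp [stat, Finset.filter_eq_empty_iff]

theorem stat_eq_one {c : Z → Bool} : stat c = 1 ↔ ∃ z, ∀ z', c z' = true ↔ z' = z := by
  simp [stat, Finset.card_eq_one, Finset.ext_iff]

/-- A nonempty column below a determined column is equal to it. -/
theorem eq_of_le_of_stat_eq_one {c d : Z → Bool} (h : ∀ z, c z = true → d z = true)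
    (hc : stat c ≠ 0) (hd : stat d = 1) : c = d :=
  eq_of_stat_eq h (by have := stat_le h; omega)

theorem SameValue.of_le {c d c' d' : Z → Bool} (h : Position.SameValue c' d')
    (hc : ∀ z, c z = true → c' z = true) (hd : ∀ z, d z = true → d' z = true)
    (hc0 : stat c ≠ 0) (hd0 : stat d ≠ 0) : Position.SameValue c d := by
  have e : c' = d' := funext h.2
  have e1 := eq_of_le_of_stat_eq_one hc hc0 h.1
  have e2 := eq_of_le_of_stat_eq_one hd hd0 (e ▸ h.1)
  rw [e1, e2]
  exact h

end Columns

namespace Position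

/-! ### Stable positions below a given one -/

/-- Positions without empty columns that are closed under deductions. -/
structure Stable (p : Position a b) : Prop where
  step_eq : step p = p
  nonempty : ¬ p.HasEmptyColumn

namespace Stable

variable {p q : Position a b}

theorem stat_m (h : Stable q) (x y) : stat (q.m x y) ≠ 0 := fun e =>
  h.nonempty (Or.inl ⟨x, y, e⟩)

theorem stat_l (h : Stable q) (x s) : stat (q.l x s) ≠ 0 := fun e =>
  h.nonempty (Or.inr (Or.inl ⟨x, s, e⟩))

theorem stat_r (h : Stable q) (s x) : stat (q.r s x) ≠ 0 := fun e =>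
  h.nonempty (Or.inr (Or.inr (Or.inl ⟨s, x, e⟩)))

/-- A round of deductions is monotone above positions without empty columns: a column that is
determined at `p` is determined with the same value at `q`. -/
theorem le_step (h : Stable q) (hp : q.Le p) : q.Le (step p) := by
  have T : ∀ x y z i, q.t x y z i = true → p.ternaryStep.t x y z i = true := by
    intro x y z i e
    have e' : q.ternaryStep.t x y z i = true := by
      change (step q).t x y z i = true
      rw [h.step_eq, e]
    simp only [ternaryStep, Bool.and_eq_true, decide_eq_true_eq] at e' ⊢
    obtain ⟨⟨-, s, h1, h2⟩, s', h3, h4⟩ := e'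
    exact ⟨⟨hp.t _ _ _ _ e, s, hp.m _ _ _ h1, hp.l _ _ _ h2⟩, s', hp.m _ _ _ h3, hp.r _ _ _ h4⟩
  have D : ∀ x y s, p.m x y s = true → stat (p.m x y) = 1 →
      q.m x y s = true ∧ stat (q.m x y) = 1 := by
    intro x y s e e1
    rw [eq_of_le_of_stat_eq_one (hp.m x y) (h.stat_m x y) e1]
    exact ⟨e, e1⟩
  have tq : q.ternaryStep.t = q.t := (congrArg Position.t h.step_eq :)
  have L : ∀ x s i, q.l x s i = true → p.ternaryStep.leftRightStep.l x s i = true := by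
    intro x s i e
    have e' : q.ternaryStep.leftRightStep.l x s i = true := by
      change (step q).l x s i = true
      rw [h.step_eq, e]
    simp only [leftRightStep, Bool.and_eq_true, decide_eq_true_eq, tq] at e' ⊢
    exact ⟨hp.l _ _ _ e, fun y z h1 h2 => T _ _ _ _ (e'.2 y z (D _ _ _ h1 h2).1 (D _ _ _ h1 h2).2)⟩
  have R : ∀ s z i, q.r s z i = true → p.ternaryStep.leftRightStep.r s z i = true := by
    intro s z i e
    have e' : q.ternaryStep.leftRightStep.r s z i = true := by
      change (step q).r s z i = true
      rw [h.step_eq, e]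
    simp only [leftRightStep, Bool.and_eq_true, decide_eq_true_eq, tq] at e' ⊢
    exact ⟨hp.r _ _ _ e, fun y z h1 h2 => T _ _ _ _ (e'.2 y z (D _ _ _ h1 h2).1 (D _ _ _ h1 h2).2)⟩
  have lq : q.ternaryStep.leftRightStep.l = q.l := (congrArg Position.l h.step_eq :)
  have rq : q.ternaryStep.leftRightStep.r = q.r := (congrArg Position.r h.step_eq :)
  have tq' : q.ternaryStep.leftRightStep.t = q.t := tq
  refine ⟨?_, L, R, T⟩
  intro x y s e
  have e' : (step q).m x y s = true := by rw [h.step_eq, e]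
  simp only [step, prodStep, Bool.and_eq_true, decide_eq_true_eq, lq, rq, tq'] at e' ⊢
  exact ⟨⟨hp.m _ _ _ e, fun z i => (e'.1.2 z i).imp (L _ _ _) (T _ _ _ _)⟩,
    fun z i => (e'.2 z i).imp (R _ _ _) (T _ _ _ _)⟩

theorem le_process (h : Stable q) (hp : q.Le p) : q.Le (process p) := by
  have : ∀ n, q.Le (step^[n] p) := by
    intro n
    induction n with
    | zero => exact hp
    | succ n ih =>
      rw [Function.iterate_succ_apply']
      exact h.le_step ih
  exact this _

theorem le_cut (h : Stable q) (hp : q.Le p) {x y : Fin a} {z : Fin (b + 1)}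
    (hz : ∀ z', q.m x y z' = true → z' = z) : q.Le (p.cut x y z) := by
  refine h.le_process ⟨fun x' y' z' e => ?_, hp.l, hp.r, hp.t⟩
  by_cases hxy : x' = x ∧ y' = y
  · obtain ⟨rfl, rfl⟩ := hxy
    simpa using hz z' e
  · simpa [hxy] using hp.m _ _ _ e

theorem cut_l (h : Stable q) (hp : q.Le p) (hl : q.l = p.l) {x y : Fin a} {z : Fin (b + 1)}
    (hz : ∀ z', q.m x y z' = true → z' = z) : q.l = (p.cut x y z).l := by
  have h1 := (h.le_cut hp hz).l
  have h2 : ∀ x' s i, (p.cut x y z).l x' s i = true → p.l x' s i = true := (process_le _).l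
  funext x' s i
  rw [Bool.eq_iff_iff]
  exact ⟨h1 x' s i, fun e => hl ▸ h2 x' s i e⟩

/-- Possibility and openness are inherited from smaller positions with the same mask of `φ`. -/
theorem active_of_le (h : Stable q) (hq : ¬ q.Impossible) (hd : ¬ q.ProdDone) (hp : q.Le p)
    (hl : q.l = p.l) : p.Active := by
  have hd' : ¬ p.ProdDone := fun e => hd fun x y => by
    rw [eq_of_le_of_stat_eq_one (hp.m x y) (h.stat_m x y) (e x y)]
    exact e x y
  refine ⟨?_, fun e => hd' e.2⟩
  rintro (he | (hB | hA) | hh)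
  · apply h.nonempty
    rcases he with ⟨x, y, e⟩ | ⟨x, y, e⟩ | ⟨x, y, e⟩ | ⟨x, y, z, e⟩
    · exact Or.inl ⟨x, y, by have := stat_le (hp.m x y); omega⟩
    · exact Or.inr (Or.inl ⟨x, y, by have := stat_le (hp.l x y); omega⟩)
    · exact Or.inr (Or.inr (Or.inl ⟨x, y, by have := stat_le (hp.r x y); omega⟩))
    · exact Or.inr (Or.inr (Or.inr ⟨x, y, z, by have := stat_le (hp.t x y z); omega⟩))
  · obtain ⟨s, s', hs, e⟩ := hB
    exact hq (Or.inr (Or.inl (Or.inl ⟨s, s', hs, fun x =>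
      ⟨SameValue.of_le (e x).1 (hp.l _ _) (hp.l _ _) (h.stat_l _ _) (h.stat_l _ _),
        SameValue.of_le (e x).2 (hp.r _ _) (hp.r _ _) (h.stat_r _ _) (h.stat_r _ _)⟩⟩)))
  · exact hd' hA.1
  · apply hq
    refine Or.inr (Or.inr ?_)
    have h1 : q.leftOnes = p.leftOnes := by simp only [leftOnes, hl]
    refine lt_of_eq_of_lt h1 (lt_of_lt_of_le hh (Finset.card_le_card fun e he => ?_))
    simp only [Finset.mem_filter, Finset.mem_univ, true_and] at he ⊢
    have h0 : q.r e.1 e.2 false = false := by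
      by_contra hf
      have := hp.r _ _ _ (Bool.eq_true_of_not_eq_false hf)
      simp [he.2] at this
    obtain ⟨i, hi⟩ := stat_pos.1 (h.stat_r e.1 e.2)
    cases i
    · simp [h0] at hi
    · exact ⟨hi, h0⟩

end Stable

/-! ### Lower bounds -/

/-- Every complete proof tree at `q`, and at any position above `q` with the same mask of `φ`, has
at least `k` passive nodes. -/
def AtLeast (q : Position a b) (k : ℕ) : Prop :=
  ∀ p, q.Le p → q.l = p.l → ∀ T : ProofTree p, T.Complete → k ≤ T.numPassive

/-- A stable position which is possible and not done. -/
structure Open (q : Position a b) : Prop extends Stable q where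
  possible : ¬ q.Impossible
  not_done : ¬ q.ProdDone

/-- Lower bounds propagate upwards: it suffices to bound, for every available cut, the number of
passive nodes below by bounds at some open positions that are compatible with the values of the cut.
A cut that is available above `q` but not at `q` has a child above `q`. -/
theorem Open.atLeast {q : Position a b} (hq : q.Open) {k : ℕ}
    (h : ∀ x y, q.Available x y → ∃ f : Fin (b + 1) → ℕ, k ≤ 1 + ∑ z, f z ∧
      ∀ z, f z ≠ 0 → ∃ q' : Position a b, q'.Open ∧ q'.Le q ∧ q'.l = q.l ∧
        (∀ z', q'.m x y z' = true → z' = z) ∧ q'.AtLeast (f z)) :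
    q.AtLeast k := by
  intro p hp hl T
  induction T with
  | leaf p => exact fun hT => absurd (hq.active_of_le hq.possible hq.not_done hp hl) hT
  | passive p act x y av below ih =>
    intro hT
    simp only [ProofTree.Complete] at hT
    simp only [ProofTree.numPassive]
    by_cases hav : q.Available x y
    · obtain ⟨f, hk, hf⟩ := h x y hav
      refine hk.trans (Nat.add_le_add_left (Finset.sum_le_sum fun z _ => ?_) 1)
      by_cases hz : f z = 0
      · simp [hz]
      obtain ⟨q', ho, hle, hl', hz', hb⟩ := hf z hz
      have hpm : p.m x y z = true := by
        obtain ⟨z', e⟩ := stat_pos.1 (ho.stat_m x y)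
        obtain rfl := hz' z' e
        exact hp.m _ _ _ (hle.m _ _ _ e)
      rw [dif_pos hpm]
      exact hb _ (ho.le_cut (hle.trans hp) hz') (ho.cut_l (hle.trans hp) (hl'.trans hl) hz') _
        (hT z hpm)
    · have h1 : stat (q.m x y) = 1 := by
        have := hq.stat_m x y
        simp only [Available] at hav
        omega
      obtain ⟨z, hz⟩ := stat_eq_one.1 h1
      have hpm := hp.m x y z ((hz z).2 rfl)
      have hz' : ∀ z', q.m x y z' = true → z' = z := fun z' => (hz z').1
      refine le_add_left ((ih z hpm (hq.le_cut hp hz') (hq.cut_l hp hl hz') (hT z hpm)).trans ?_)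
      refine le_trans (le_of_eq ?_)
        (Finset.single_le_sum (f := fun z => if h : p.m x y z = true then (below z h).numPassive
          else 0) (fun _ _ => Nat.zero_le _) (Finset.mem_univ z))
      rw [dif_pos hpm]

/-! ### Upper bounds -/

/-- There is a complete proof tree at `p` with at most `n` passive nodes. -/
def AtMost (p : Position a b) (n : ℕ) : Prop :=
  ∃ T : ProofTree p, T.Complete ∧ T.numPassive ≤ n

theorem atMost_of_not_active {p : Position a b} (h : ¬ p.Active) (n : ℕ) : p.AtMost n :=
  ⟨.leaf p, h, Nat.zero_le _⟩

theorem atMost_of_cut {p : Position a b} {x y : Fin a} (av : p.Available x y)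
    (f : Fin (b + 1) → ℕ) (h : ∀ z, p.m x y z = true → (p.cut x y z).AtMost (f z)) :
    p.AtMost (1 + ∑ z, f z) := by
  by_cases act : p.Active
  · choose T hT hn using h
    refine ⟨.passive p act x y av T, hT, ?_⟩
    simp only [ProofTree.numPassive]
    refine Nat.add_le_add_left (Finset.sum_le_sum fun z _ => ?_) 1
    split_ifs with hz
    · exact hn z hz
    · exact Nat.zero_le _
  · exact atMost_of_not_active act _

end Position

/-! ### Optimal cuts -/

/-- The possible sizes of complete proof trees at `p` whose first cut is at `(x, y)`. -/
def cutSizes (p : Position a b) (x y : Fin a) : Set ℕ :=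
  {n | ∃ act av below, (ProofTree.passive p act x y av below).Complete ∧
    (ProofTree.passive p act x y av below).numPassive = n}

/-- The minimal size of a complete proof tree whose first cut is at `(x, y)`. -/
noncomputable def optimalScore (p : Position a b) (x y : Fin a) : ℝ :=
  (sInf (cutSizes p x y) : ℕ)

/-- Every position has a complete proof tree, since each cut deletes entries of the mask of `μ`. -/
theorem exists_complete (p : Position a b) : ∃ T : ProofTree p, T.Complete := by
  have key : ∀ n : ℕ, ∀ p : Position a b, ∑ x, ∑ y, stat (p.m x y) ≤ n →
      ∃ T : ProofTree p, T.Complete := by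
    intro n
    induction n with
    | zero =>
      intro p hp
      refine ⟨.leaf p, fun act => act.2 ⟨act.1, fun x y => absurd ?_ act.1⟩⟩
      refine Or.inl (Or.inl ⟨x, y, ?_⟩)
      simp only [nonpos_iff_eq_zero, Finset.sum_eq_zero_iff, Finset.mem_univ, true_imp_iff] at hp
      exact hp x y
    | succ n ih =>
      intro p hp
      by_cases act : p.Active
      · obtain ⟨x, y, av⟩ : ∃ x y, p.Available x y := by
          by_contra! hno
          refine act.2 ⟨act.1, fun x y => ?_⟩
          have h1 : stat (p.m x y) ≠ 0 := fun e => act.1 (Or.inl (Or.inl ⟨x, y, e⟩))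
          have h2 := hno x y
          simp only [Position.Available] at h2
          omega
        have hc : ∀ z, p.m x y z = true → ∃ T : ProofTree (p.cut x y z), T.Complete := by
          intro z hz
          apply ih
          have le : ∀ x' y' z', (p.cut x y z).m x' y' z' = true → p.m x' y' z' = true := by
            intro x' y' z' e
            have e' := (Position.process_le _).m x' y' z' e
            by_cases hxy : x' = x ∧ y' = y
            · obtain ⟨rfl, rfl⟩ := hxy
              simp only [and_self, if_true, decide_eq_true_eq] at e'
              rwa [e']
            · simpa [hxy] using e'
          have lt : stat ((p.cut x y z).m x y) < stat (p.m x y) := by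
            have h1 : stat ((p.cut x y z).m x y) ≤ stat fun z' => decide (z' = z) :=
              stat_le fun z' e => by simpa using (Position.process_le _).m x y z' e
            have h2 : (stat fun z' => decide (z' = z)) = 1 := stat_eq_one.2 ⟨z, by simp⟩
            simp only [Position.Available] at av
            omega
          have : ∑ x', ∑ y', stat ((p.cut x y z).m x' y') < ∑ x', ∑ y', stat (p.m x' y') :=
            Finset.sum_lt_sum (fun x' _ => Finset.sum_le_sum fun y' _ => stat_le (le x' y'))
              ⟨x, Finset.mem_univ x, Finset.sum_lt_sum (fun y' _ => stat_le (le x y'))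
                ⟨y, Finset.mem_univ y, lt⟩⟩
          omega
        choose T hT using hc
        exact ⟨.passive p act x y av T, hT⟩
      · exact ⟨.leaf p, act⟩
  exact key _ p le_rfl

theorem sInf_proofSizes_le {p : Position a b} {T : ProofTree p} (hT : T.Complete) :
    sInf (proofSizes p) ≤ T.numPassive :=
  Nat.sInf_le ⟨T, hT, rfl⟩

theorem exists_optimal (p : Position a b) :
    ∃ T : ProofTree p, T.Complete ∧ T.numPassive = sInf (proofSizes p) := by
  obtain ⟨T, hT⟩ := exists_complete p
  exact Nat.sInf_mem (s := proofSizes p) ⟨_, T, hT, rfl⟩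

/-- At an active position there is a cut whose score is the minimal size of a proof. -/
theorem exists_optimal_passive {p : Position a b} (act : p.Active) :
    ∃ x y, ∃ av : p.Available x y, ∃ below : (z : Fin (b + 1)) → p.m x y z = true →
      ProofTree (p.cut x y z), (ProofTree.passive p act x y av below).Complete ∧
        (ProofTree.passive p act x y av below).numPassive = sInf (proofSizes p) := by
  obtain ⟨T, hT, hn⟩ := exists_optimal p
  cases T with
  | leaf => exact absurd act hT
  | passive _ _ x y av below => exact ⟨x, y, av, below, hT, hn⟩

theorem cutSizes_nonempty {p : Position a b} (act : p.Active) {x y : Fin a}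
    (av : p.Available x y) : (cutSizes p x y).Nonempty := by
  choose T hT using fun z => exists_complete (p.cut x y z)
  exact ⟨_, act, av, fun z _ => T z, fun z _ => hT z, rfl⟩

theorem sInf_proofSizes_le_optimalScore {p : Position a b} (act : p.Active) {x y : Fin a}
    (av : p.Available x y) : (sInf (proofSizes p) : ℕ) ≤ optimalScore p x y := by
  obtain ⟨_, _, _, hT, hn⟩ := Nat.sInf_mem (cutSizes_nonempty act av)
  rw [optimalScore, ← hn]
  exact_mod_cast sInf_proofSizes_le hT

/-- Every proof that follows the optimal score is minimal, however ties are broken. -/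
theorem numPassive_of_follows {p : Position a b} (T : ProofTree p) (hT : T.Complete)
    (hF : T.Follows optimalScore) : T.numPassive = sInf (proofSizes p) := by
  induction T with
  | leaf p => exact (Nat.le_zero.1 (sInf_proofSizes_le (T := .leaf p) hT)).symm
  | passive p act x y av below ih =>
    refine le_antisymm ?_ (sInf_proofSizes_le hT)
    obtain ⟨x₀, y₀, av₀, below₀, hT₀, hn₀⟩ := exists_optimal_passive act
    obtain ⟨_, _, below₁, hT₁, hn₁⟩ := Nat.sInf_mem (cutSizes_nonempty act av)
    have h1 : sInf (cutSizes p x y) ≤ sInf (cutSizes p x₀ y₀) := by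
      exact Nat.cast_le.1 (hF.1 x₀ y₀ av₀)
    have h2 : sInf (cutSizes p x₀ y₀) ≤ sInf (proofSizes p) :=
      hn₀ ▸ Nat.sInf_le ⟨act, av₀, below₀, hT₀, rfl⟩
    refine le_trans ?_ (hn₁.le.trans (h1.trans h2))
    simp only [ProofTree.numPassive]
    refine Nat.add_le_add_left (Finset.sum_le_sum fun z _ => ?_) 1
    split_ifs with hz
    · rw [ih z hz (hT z hz) (hF.2 z hz)]
      exact sInf_proofSizes_le (hT₁ z hz)
    · exact le_rfl

theorem exists_follows (p : Position a b) :
    ∃ T : ProofTree p, T.Complete ∧ T.Follows optimalScore := by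
  have key : ∀ n : ℕ, ∀ p : Position a b, sInf (proofSizes p) < n →
      ∃ T : ProofTree p, T.Complete ∧ T.Follows optimalScore := by
    intro n
    induction n with
    | zero => exact fun p hp => absurd hp (Nat.not_lt_zero _)
    | succ n ih =>
      intro p hp
      by_cases act : p.Active
      · obtain ⟨x, y, av, below, hT, hn⟩ := exists_optimal_passive act
        have hc : ∀ z, p.m x y z = true →
            ∃ T : ProofTree (p.cut x y z), T.Complete ∧ T.Follows optimalScore := by
          intro z hz
          apply ih
          have h1 := sInf_proofSizes_le (hT z hz)
          have h2 : (below z hz).numPassive ≤ ∑ z, if h : p.m x y z = true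
              then (below z h).numPassive else 0 := by
            refine le_trans (le_of_eq ?_) (Finset.single_le_sum
              (f := fun z => if h : p.m x y z = true then (below z h).numPassive else 0)
              (fun _ _ => Nat.zero_le _) (Finset.mem_univ z))
            rw [dif_pos hz]
          simp only [ProofTree.numPassive] at hn
          omega
        choose T hT' hF using hc
        refine ⟨.passive p act x y av T, hT', fun x' y' av' => ?_, hF⟩
        refine le_trans ?_ (sInf_proofSizes_le_optimalScore act av')
        rw [← hn]
        exact Nat.cast_le.2 (Nat.sInf_le ⟨act, av, below, hT, rfl⟩)
      · exact ⟨.leaf p, act, trivial⟩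
  exact key _ p (Nat.lt_succ_self _)

namespace Packed

/-! ### Boolean tensors packed into natural numbers -/

/-- The place of the entry with indices `x, y, z` in `A`, `q` in `B⁰` and `i` in `I⁰`. -/
def idx (x y z q : Fin 3) (i : Bool) : ℕ :=
  27 + 54 * x.val + 18 * y.val + 6 * z.val + 2 * q.val + i.toNat

/-- The tensor with five indices which is packed into `N`. -/
def val (N : ℕ) (x y z q : Fin 3) (i : Bool) : Bool :=
  N.testBit (idx x y z q i)

/-- The last `27` binary digits of a packed tensor are a label without meaning, carried along by
most operations. The kernel looks up terms that it has evaluated by a hash which sees only the last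
`64` digits of a numeral; labels, which tell the positions apart, keep this hash from having few
values. -/
def labelMask : ℕ := Nat.sub (Nat.pow 2 27) 1

/-- The tensor all of whose entries are `1`. This and all other functions on packed tensors are
written with those functions on natural numbers which the kernel evaluates at numerals directly. -/
def full : ℕ := Nat.shiftLeft (Nat.sub (Nat.pow 2 162) 1) 27

/-- The tensor whose entries are `1` where the index of the axis with stride `s` is not `2`. -/
def lowMask (s : ℕ) : ℕ :=
  Nat.mul (Nat.div full (Nat.sub (Nat.pow 2 (Nat.mul 3 s)) 1)) (Nat.sub (Nat.pow 2 (Nat.mul 2 s)) 1)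

/-- The tensor whose entries are `1` where the index of the axis with stride `s` is `2`. -/
def highMask (s : ℕ) : ℕ := Nat.xor full (lowMask s)

/-- The tensor whose entries are `1` where the index of the axis with stride `s` is `0`. -/
def zeroMask (s : ℕ) : ℕ :=
  Nat.mul (Nat.div full (Nat.sub (Nat.pow 2 (Nat.mul 3 s)) 1)) (Nat.sub (Nat.pow 2 s) 1)

/-- Cyclic shift by one along an axis of length three with stride `s`. -/
def rot (s N : ℕ) : ℕ :=
  Nat.lor (Nat.land (Nat.shiftRight N s) (lowMask s))
    (Nat.land (Nat.shiftLeft N (Nat.mul 2 s)) (highMask s))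

/-- Cyclic shift by two along an axis of length three with stride `s`. -/
def rotTwo (s N : ℕ) : ℕ :=
  Nat.lor (Nat.land (Nat.shiftRight N (Nat.mul 2 s)) (zeroMask s))
    (Nat.land (Nat.shiftLeft N s) (Nat.xor full (zeroMask s)))

/-- The tensor whose entries are `1` where the index `i` is `false`. -/
def falseMask : ℕ := Nat.div full 3

/-- Exchange of the two values of the index `i`. -/
def flip (N : ℕ) : ℕ :=
  Nat.lor (Nat.lor (Nat.land (Nat.shiftRight N 1) falseMask)
    (Nat.land (Nat.shiftLeft N 1) (Nat.mul 2 falseMask))) (Nat.land N labelMask)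

/-- Evaluation of a natural number before it is passed on: the recursor unfolds only if its argument
is a numeral. This changes how terms are evaluated, and no value. -/
def force {α : Type} (n : ℕ) (f : ℕ → α) : α :=
  Nat.rec (motive := fun _ => α) (f 0) (fun k _ => f k) (Nat.add n 1)

@[simp] theorem force_eq {α : Type} (n : ℕ) (f : ℕ → α) : force n f = f n := (rfl)

/-- The entrywise negation of a tensor; the label is kept. -/
def compl (N : ℕ) : ℕ := Nat.xor full N

/-- Disjunction over the axis with stride `s`; the result is constant along this axis. -/
def any (s N : ℕ) : ℕ :=
  force N fun N => Nat.lor N (Nat.lor (rot s N) (rotTwo s N))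

/-- Disjunction over the index `i`. -/
def anyI (N : ℕ) : ℕ :=
  force N fun N => Nat.lor N (flip N)

theorem val_full : ∀ x y z q i, val full x y z q i = true := by decide +kernel

theorem val_lowMask : ∀ x y z q i,
    val (lowMask 54) x y z q i = decide (x ≠ 2) ∧ val (lowMask 18) x y z q i = decide (y ≠ 2) ∧
    val (lowMask 6) x y z q i = decide (z ≠ 2) ∧ val (lowMask 2) x y z q i = decide (q ≠ 2) := by
  decide +kernel

theorem val_zeroMask : ∀ x y z q i,
    val (zeroMask 54) x y z q i = decide (x = 0) ∧ val (zeroMask 18) x y z q i = decide (y = 0) ∧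
    val (zeroMask 6) x y z q i = decide (z = 0) ∧ val (zeroMask 2) x y z q i = decide (q = 0) := by
  decide +kernel

theorem val_labelMask : ∀ x y z q i, val labelMask x y z q i = false := by
  decide +kernel

theorem val_falseMask : ∀ x y z q i, val falseMask x y z q i = !i ∧
    val (Nat.mul 2 falseMask) x y z q i = i := by
  decide +kernel

section

variable (N M : ℕ) (x y z q : Fin 3) (i : Bool)

theorem val_lor : val (Nat.lor N M) x y z q i = (val N x y z q i || val M x y z q i) :=
  Nat.testBit_or N M _

theorem val_land : val (Nat.land N M) x y z q i = (val N x y z q i && val M x y z q i) :=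
  Nat.testBit_and N M _

theorem val_xor : val (Nat.xor N M) x y z q i = (val N x y z q i ^^ val M x y z q i) :=
  Nat.testBit_xor N M _

theorem val_or : val (N ||| M) x y z q i = (val N x y z q i || val M x y z q i) :=
  Nat.testBit_or N M _

theorem val_and : val (N &&& M) x y z q i = (val N x y z q i && val M x y z q i) :=
  Nat.testBit_and N M _

theorem val_compl : val (compl N) x y z q i = !val N x y z q i := by
  simp only [compl, val_xor, val_full, Bool.true_xor]

theorem val_shiftRight (s : ℕ) :
    val (Nat.shiftRight N s) x y z q i = N.testBit (s + idx x y z q i) :=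
  Nat.testBit_shiftRight N

theorem val_shiftLeft (s : ℕ) : val (Nat.shiftLeft N s) x y z q i =
    (decide (s ≤ idx x y z q i) && N.testBit (idx x y z q i - s)) :=
  Nat.testBit_shiftLeft N

theorem val_rot_x : val (rot 54 N) x y z q i = val N (x + 1) y z q i := by
  simp only [rot, highMask, val_lor, val_land, val_xor, val_full, (val_lowMask x y z q i).1,
    val_shiftRight, val_shiftLeft]
  fin_cases x <;> simp [val, idx] <;> grind

theorem val_rot_y : val (rot 18 N) x y z q i = val N x (y + 1) z q i := by
  simp only [rot, highMask, val_lor, val_land, val_xor, val_full, (val_lowMask x y z q i).2.1,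
    val_shiftRight, val_shiftLeft]
  fin_cases y <;> simp [val, idx] <;> grind

theorem val_rot_z : val (rot 6 N) x y z q i = val N x y (z + 1) q i := by
  simp only [rot, highMask, val_lor, val_land, val_xor, val_full, (val_lowMask x y z q i).2.2.1,
    val_shiftRight, val_shiftLeft]
  fin_cases z <;> simp [val, idx] <;> grind

theorem val_rot_q : val (rot 2 N) x y z q i = val N x y z (q + 1) i := by
  simp only [rot, highMask, val_lor, val_land, val_xor, val_full, (val_lowMask x y z q i).2.2.2,
    val_shiftRight, val_shiftLeft]
  fin_cases q <;> simp [val, idx] <;> grind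

theorem val_rotTwo_x : val (rotTwo 54 N) x y z q i = val N (x + 1 + 1) y z q i := by
  simp only [rotTwo, val_lor, val_land, val_xor, val_full, (val_zeroMask x y z q i).1,
    val_shiftRight, val_shiftLeft]
  fin_cases x <;> simp [val, idx] <;> grind

theorem val_rotTwo_y : val (rotTwo 18 N) x y z q i = val N x (y + 1 + 1) z q i := by
  simp only [rotTwo, val_lor, val_land, val_xor, val_full, (val_zeroMask x y z q i).2.1,
    val_shiftRight, val_shiftLeft]
  fin_cases y <;> simp [val, idx] <;> grind

theorem val_rotTwo_z : val (rotTwo 6 N) x y z q i = val N x y (z + 1 + 1) q i := by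
  simp only [rotTwo, val_lor, val_land, val_xor, val_full, (val_zeroMask x y z q i).2.2.1,
    val_shiftRight, val_shiftLeft]
  fin_cases z <;> simp [val, idx] <;> grind

theorem val_rotTwo_q : val (rotTwo 2 N) x y z q i = val N x y z (q + 1 + 1) i := by
  simp only [rotTwo, val_lor, val_land, val_xor, val_full, (val_zeroMask x y z q i).2.2.2,
    val_shiftRight, val_shiftLeft]
  fin_cases q <;> simp [val, idx] <;> grind

theorem val_flip : val (flip N) x y z q i = val N x y z q (!i) := by
  simp only [flip, val_lor, val_land, (val_falseMask x y z q i).1, (val_falseMask x y z q i).2,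
    val_labelMask, val_shiftRight, val_shiftLeft]
  cases i <;> simp [val, idx]
  grind

end

theorem exists_fin_three_iff {P : Fin 3 → Prop} (x : Fin 3) :
    (∃ y, P y) ↔ P x ∨ P (x + 1) ∨ P (x + 1 + 1) := by
  fin_cases x <;> simp [Fin.exists_fin_succ, Fin.reduceAdd] <;> tauto

section

variable (N : ℕ) (x y z q : Fin 3) (i : Bool)

theorem val_any_x : val (any 54 N) x y z q i = true ↔ ∃ x, val N x y z q i = true := by
  rw [exists_fin_three_iff x]; simp [any, val_or, val_rot_x, val_rotTwo_x]

theorem val_any_y : val (any 18 N) x y z q i = true ↔ ∃ y, val N x y z q i = true := by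
  rw [exists_fin_three_iff y]; simp [any, val_or, val_rot_y, val_rotTwo_y]

theorem val_any_z : val (any 6 N) x y z q i = true ↔ ∃ z, val N x y z q i = true := by
  rw [exists_fin_three_iff z]; simp [any, val_or, val_rot_z, val_rotTwo_z]

theorem val_any_q : val (any 2 N) x y z q i = true ↔ ∃ q, val N x y z q i = true := by
  rw [exists_fin_three_iff q]; simp [any, val_or, val_rot_q, val_rotTwo_q]

theorem val_anyI : val (anyI N) x y z q i = true ↔ ∃ i, val N x y z q i = true := by
  cases i <;> simp [anyI, val_or, val_flip, or_comm]

end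

/-- The tensor whose entries are `1` where `y = z`. -/
def diagYZ : ℕ := Nat.lor labelMask (Nat.shiftLeft
  (Nat.mul (Nat.add (Nat.add (Nat.pow 2 0) (Nat.pow 2 24)) (Nat.pow 2 48))
    (Nat.mul 63 (Nat.add (Nat.add 1 (Nat.pow 2 54)) (Nat.pow 2 108)))) 27)

/-- The tensor whose entries are `1` where `x = y`. -/
def diagXY : ℕ := Nat.lor labelMask (Nat.shiftLeft
  (Nat.mul (Nat.add (Nat.add (Nat.pow 2 0) (Nat.pow 2 72)) (Nat.pow 2 144))
    (Nat.sub (Nat.pow 2 18) 1)) 27)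

theorem val_diag : ∀ x y z q i, val diagYZ x y z q i = decide (y = z) ∧
    val diagXY x y z q i = decide (x = y) := by
  decide +kernel

/-- A tensor depending on `x, y`, moved to the places of `y, z`. -/
def moveUp (N : ℕ) : ℕ := any 54 (Nat.land diagXY (any 18 (Nat.land diagYZ N)))

/-- A tensor depending on `y, z`, moved to the places of `x, y`. -/
def moveDown (N : ℕ) : ℕ := any 6 (Nat.land diagYZ (any 18 (Nat.land diagXY N)))

theorem val_moveUp {N : ℕ} {f : Fin 3 → Fin 3 → Fin 3 → Bool → Prop}
    (h : ∀ x y z q i, val N x y z q i = true ↔ f x y q i) (x y z q i) :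
    val (moveUp N) x y z q i = true ↔ f y z q i := by
  simp [moveUp, val_any_x, val_any_y, val_and, (val_diag _ _ _ _ _).1, (val_diag _ _ _ _ _).2, h]

theorem val_moveDown {N : ℕ} {f : Fin 3 → Fin 3 → Fin 3 → Bool → Prop}
    (h : ∀ x y z q i, val N x y z q i = true ↔ f y z q i) (x y z q i) :
    val (moveDown N) x y z q i = true ↔ f x y q i := by
  simp [moveDown, val_any_y, val_any_z, val_and, (val_diag _ _ _ _ _).1, (val_diag _ _ _ _ _).2, h]

theorem testBit_full (j : ℕ) : full.testBit j = (decide (27 ≤ j) && decide (j - 27 < 162)) := by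
  change ((2 ^ 162 - 1) <<< 27).testBit j = _
  rw [Nat.testBit_shiftLeft, Nat.testBit_two_pow_sub_one]

theorem idx_bounds (x y z q : Fin 3) (i : Bool) :
    27 ≤ idx x y z q i ∧ idx x y z q i - 27 < 162 := by
  have := i.toNat_lt
  simp only [idx]
  omega

/-- Tensors with the same entries agree up to their labels. -/
theorem land_full_congr {N M : ℕ} (h : ∀ x y z q i, val N x y z q i = val M x y z q i) :
    Nat.land full N = Nat.land full M := by
  apply Nat.eq_of_testBit_eq
  intro j
  change (full &&& N).testBit j = (full &&& M).testBit j
  rw [Nat.testBit_and, Nat.testBit_and, testBit_full]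
  by_cases hj : 27 ≤ j ∧ j - 27 < 162
  · obtain ⟨k, rfl⟩ := Nat.exists_eq_add_of_le hj.1
    have hk : k < 162 := by omega
    have := h ⟨k / 54, by omega⟩ ⟨k / 18 % 3, by omega⟩ ⟨k / 6 % 3, by omega⟩ ⟨k / 2 % 3, by omega⟩
      (decide (k % 2 = 1))
    have hi : idx ⟨k / 54, by omega⟩ ⟨k / 18 % 3, by omega⟩ ⟨k / 6 % 3, by omega⟩
        ⟨k / 2 % 3, by omega⟩ (decide (k % 2 = 1)) = 27 + k := by
      rcases Nat.mod_two_eq_zero_or_one k with e | e <;> simp [idx, e] <;> omega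
    rw [val, val, hi] at this
    rw [this]
  · rw [← Bool.decide_and, decide_eq_false hj, Bool.false_and, Bool.false_and]

theorem val_eq_of_land_full_eq {N M : ℕ} (h : Nat.land full N = Nat.land full M)
    (x y z q : Fin 3) (i : Bool) : val N x y z q i = val M x y z q i := by
  have := congrArg (fun K => val K x y z q i) h
  simpa only [val_land, val_full, Bool.true_and] using this

theorem land_full_eq_full {N : ℕ} :
    Nat.land full N = full ↔ ∀ x y z q i, val N x y z q i = true := by
  have hf : Nat.land full full = full := Nat.and_self full
  constructor
  · intro h x y z q i
    rw [val_eq_of_land_full_eq (h.trans hf.symm), val_full]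
  · intro h
    exact (land_full_congr fun x y z q i => (h x y z q i).trans (val_full x y z q i).symm).trans hf

/-! ### Packed positions -/

/-- Four packed tensors, for the masks of a position: the mask of `μ` depends on the indices `x, y,
q`, the mask of `φ` on `x, q, i`, the mask of `ψ` on `z, q, i` and the mask of `τ` on `x, y, z, i`.
-/
structure Code where
  m : ℕ
  l : ℕ
  r : ℕ
  t : ℕ

/-- The code `c` represents the position `p`. -/
structure Rep (c : Code) (p : Position 3 2) : Prop where
  m : ∀ x y z q i, val c.m x y z q i = p.m x y q
  l : ∀ x y z q i, val c.l x y z q i = p.l x q i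
  r : ∀ x y z q i, val c.r x y z q i = p.r q z i
  t : ∀ x y z q i, val c.t x y z q i = p.t x y z i

theorem Rep.unique {c : Code} {p p' : Position 3 2} (h : Rep c p) (h' : Rep c p') : p = p' := by
  obtain ⟨m, l, r, t⟩ := p
  obtain ⟨m', l', r', t'⟩ := p'
  obtain rfl : m = m' := by
    funext x y q
    exact (h.m x y 0 q true).symm.trans (h'.m x y 0 q true)
  obtain rfl : l = l' := by
    funext x q i
    exact (h.l x 0 0 q i).symm.trans (h'.l x 0 0 q i)
  obtain rfl : r = r' := by
    funext q z i
    exact (h.r 0 0 z q i).symm.trans (h'.r 0 0 z q i)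
  obtain rfl : t = t' := by
    funext x y z i
    exact (h.t x y z 0 i).symm.trans (h'.t x y z 0 i)
  rfl

/-- The entries of the determined columns, for columns along `q`. -/
def determined (N : ℕ) : ℕ :=
  force N fun N => Nat.xor N (Nat.land N (Nat.lor (rot 2 N) (rotTwo 2 N)))

theorem val_determined (N : ℕ) (x y z q : Fin 3) (i : Bool) :
    val (determined N) x y z q i =
      (val N x y z q i && !(val N x y z (q + 1) i || val N x y z (q + 1 + 1) i)) := by
  simp only [determined, force_eq, val_xor, val_land, val_lor, val_rot_q, val_rotTwo_q]
  cases val N x y z q i <;> simp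

theorem stat_eq_one_iff (c : Fin 3 → Bool) (q : Fin 3) (h : c q = true) :
    stat c = 1 ↔ c (q + 1) = false ∧ c (q + 1 + 1) = false := by
  revert c q
  decide +kernel

/-- One round of deductions. -/
def step (c : Code) : Code :=
  force (moveUp c.m) fun m' =>
  force (Nat.land c.t (Nat.land (any 2 (Nat.land m' c.l)) (any 2 (Nat.land c.m c.r)))) fun t =>
  force (compl t) fun nt =>
  force (Nat.land c.l (compl (any 18 (any 6 (Nat.land (determined m') nt))))) fun l =>
  force (Nat.land c.r (compl (any 54 (any 18 (Nat.land (determined c.m) nt))))) fun r =>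
  force (flip nt) fun nt' =>
  force (Nat.land c.m (Nat.land (compl (moveDown (any 54 (anyI (Nat.land (compl l) nt')))))
    (compl (any 6 (anyI (Nat.land (compl r) nt')))))) fun m =>
  ⟨m, l, r, t⟩

theorem Rep.step {c : Code} {p : Position 3 2} (h : Rep c p) : Rep (step c) p.step := by
  have hm' : ∀ x y z q i, val (moveUp c.m) x y z q i = p.m y z q := fun x y z q i => by
    rw [Bool.eq_iff_iff, val_moveUp (f := fun x y q _ => p.m x y q = true)]
    simp [h.m]
  have ht : ∀ x y z q i, val (Packed.step c).t x y z q i = p.step.t x y z i := by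
    intro x y z q i
    simp only [Packed.step, force_eq, Position.step, Position.ternaryStep, Position.leftRightStep,
      Position.prodStep]
    rw [Bool.eq_iff_iff]
    simp only [val_land, Bool.and_eq_true, val_any_q, hm', h.m, h.l, h.r, h.t, decide_eq_true_eq]
    tauto
  have det : ∀ x y q, (p.m x y q = true ∧ p.m x y (q + 1) = false ∧ p.m x y (q + 1 + 1) = false) ↔
      (p.m x y q = true ∧ stat (p.m x y) = 1) := fun x y q =>
    and_congr_right fun e => (stat_eq_one_iff _ q e).symm
  have hd : ∀ x y z q i, val (determined c.m) x y z q i = true ↔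
      p.m x y q = true ∧ stat (p.m x y) = 1 := by
    intro x y z q i
    rw [← det]
    simp [val_determined, h.m]
  have hd' : ∀ x y z q i, val (determined (moveUp c.m)) x y z q i = true ↔
      p.m y z q = true ∧ stat (p.m y z) = 1 := by
    intro x y z q i
    rw [← det]
    simp [val_determined, hm']
  have hl : ∀ x y z q i, val (Packed.step c).l x y z q i = p.step.l x q i := by
    intro x y z q i
    have e : (Packed.step c).l = Nat.land c.l (compl (any 18 (any 6
      (Nat.land (determined (moveUp c.m)) (compl (Packed.step c).t))))) := rfl
    rw [e, Bool.eq_iff_iff, val_land, val_compl, Bool.and_eq_true, h.l, Bool.not_eq_true',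
      Bool.eq_false_iff, Ne, val_any_y]
    simp only [val_any_z, val_land, Bool.and_eq_true, hd', val_compl, ht]
    simp only [Position.step, Position.ternaryStep, Position.leftRightStep,
      Position.prodStep, Bool.and_eq_true, decide_eq_true_eq]
    grind
  have hr : ∀ x y z q i, val (Packed.step c).r x y z q i = p.step.r q z i := by
    intro x y z q i
    have e : (Packed.step c).r = Nat.land c.r (compl (any 54 (any 18
      (Nat.land (determined c.m) (compl (Packed.step c).t))))) := rfl
    rw [e, Bool.eq_iff_iff, val_land, val_compl, Bool.and_eq_true, h.r, Bool.not_eq_true',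
      Bool.eq_false_iff, Ne, val_any_x]
    simp only [val_any_y, val_land, Bool.and_eq_true, hd, val_compl, ht]
    simp only [Position.step, Position.ternaryStep, Position.leftRightStep,
      Position.prodStep, Bool.and_eq_true, decide_eq_true_eq]
    grind
  refine ⟨?_, hl, hr, ht⟩
  intro x y z q i
  have e : (Packed.step c).m = Nat.land c.m (Nat.land
    (compl (moveDown (any 54 (anyI (Nat.land (compl (Packed.step c).l)
      (flip (compl (Packed.step c).t)))))))
    (compl (any 6 (anyI (Nat.land (compl (Packed.step c).r)
      (flip (compl (Packed.step c).t))))))) := rfl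
  have hk := val_moveDown (N := any 54 (anyI (Nat.land (compl (Packed.step c).l)
      (flip (compl (Packed.step c).t))))) (f := fun x y q _ => ∃ z i, p.step.l z q i = false ∧
      p.step.t z x y (!i) = false) (by
    intro x y z q i
    simp [val_any_x, val_anyI, val_and, val_compl, val_flip, hl, ht])
  rw [e, Bool.eq_iff_iff, val_land, val_land, val_compl, val_compl, Bool.and_eq_true,
    Bool.and_eq_true, Bool.not_eq_true', Bool.not_eq_true', Bool.eq_false_iff, Bool.eq_false_iff,
    Ne, Ne, hk, val_any_z, h.m]
  have em : p.step.m x y q = true ↔ p.m x y q = true ∧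
      (∀ z i, p.step.l z q i = true ∨ p.step.t z x y (!i) = true) ∧
      (∀ z i, p.step.r q z i = true ∨ p.step.t x y z (!i) = true) := by
    simp only [Position.step, Position.ternaryStep, Position.leftRightStep,
      Position.prodStep, Bool.and_eq_true, decide_eq_true_eq, and_assoc]
  rw [em]
  simp only [val_anyI, val_land, val_compl, val_flip, hr, ht, Bool.and_eq_true, Bool.not_eq_true',
    not_exists, not_and, Bool.not_eq_false]
  refine and_congr_right fun _ => and_congr (forall₂_congr fun z i => ?_)
    (forall₂_congr fun z i => ?_)
  · rw [or_iff_not_imp_left, Bool.not_eq_true]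
  · rw [or_iff_not_imp_left, Bool.not_eq_true]

/-! ### The filter on packed positions -/

/-- All entries of the tensor are `1`. -/
def isFull (N : ℕ) : Bool := Nat.beq (Nat.land full N) full

theorem isFull_iff {N : ℕ} : isFull N = true ↔ ∀ x y z q i, val N x y z q i = true := by
  rw [isFull, Nat.beq_eq, land_full_eq_full]

/-- No column is empty. -/
def nonempty (c : Code) : Bool :=
  isFull (any 2 c.m) && (isFull (anyI c.l) && (isFull (anyI c.r) && isFull (anyI c.t)))

/-- All columns of the mask of `μ` are determined. -/
def prodDone (c : Code) : Bool := isFull (any 2 (determined c.m))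

/-- The entry for `q` is `1` if the multiplication profiles of `q` and `q + 1` are not known to be
equal. -/
def profileDiff (c : Code) : ℕ :=
  any 54 (any 6 (anyI (Nat.lor
    (Nat.lor (Nat.xor c.l (rot 2 c.l)) (compl (Nat.xor c.l (flip c.l))))
    (Nat.lor (Nat.xor c.r (rot 2 c.r)) (compl (Nat.xor c.r (flip c.r)))))))

/-- The binary digit of `N` at the place `j`, as a number. -/
def bit (N j : ℕ) : ℕ := Nat.land (Nat.shiftRight N j) 1

/-- The sum of the entries of a tensor for the nine values of `q` and of the index of stride `s`,
the index `i` being `true`, and the other indices `0`. -/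
def countOnes (s N : ℕ) : ℕ :=
  Nat.add (Nat.add (Nat.add (bit N 28) (bit N 30)) (bit N 32))
    (Nat.add
      (Nat.add (Nat.add (bit N (Nat.add s 28)) (bit N (Nat.add s 30))) (bit N (Nat.add s 32)))
      (Nat.add (Nat.add (bit N (Nat.add (Nat.mul 2 s) 28)) (bit N (Nat.add (Nat.mul 2 s) 30)))
        (bit N (Nat.add (Nat.mul 2 s) 32))))

/-- The half-ones filter lets the position pass. -/
def halfOnes (c : Code) : Bool :=
  force (Nat.land c.l (compl (flip c.l))) fun l => force (Nat.land c.r (compl (flip c.r))) fun r =>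
    Nat.ble (countOnes 6 r) (countOnes 54 l)

/-- The filter lets the position pass, the profile filter on `A` being left out. -/
def possible (c : Code) : Bool := nonempty c && (isFull (profileDiff c) && halfOnes c)

theorem bit_eq (N j : ℕ) : bit N j = (N.testBit j).toNat := by
  change (N >>> j) &&& 1 = _
  rw [Nat.toNat_testBit, Nat.and_one_is_mod, Nat.shiftRight_eq_div_pow]

theorem sameValue_bool (c d : Bool → Bool) :
    Position.SameValue c d ↔ ∀ i, c i = d i ∧ c i ≠ c (!i) := by
  unfold Position.SameValue
  revert c d
  decide +kernel

theorem sameProfileB_iff (p : Position 3 2) : p.SameProfileB ↔ ∃ q : Fin 3, ∀ x i,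
    (p.l x q i = p.l x (q + 1) i ∧ p.l x q i ≠ p.l x q (!i)) ∧
      p.r q x i = p.r (q + 1) x i ∧ p.r q x i ≠ p.r q x (!i) := by
  have key : ∀ q q' : Fin 3, q ≠ q' → q' = q + 1 ∨ q = q' + 1 := by decide
  simp only [Position.SameProfileB, sameValue_bool, ← forall_and]
  constructor
  · rintro ⟨q, q', hne, h⟩
    rcases key q q' hne with rfl | rfl
    · exact ⟨q, h⟩
    · refine ⟨q', fun x i => ?_⟩
      have h1 := h x i
      have h2 := h x (!i)
      refine ⟨⟨h1.1.1.symm, ?_⟩, h1.2.1.symm, ?_⟩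
      · rw [← h1.1.1, ← h2.1.1]
        exact h1.1.2
      · rw [← h1.2.1, ← h2.2.1]
        exact h1.2.2
  · rintro ⟨q, h⟩
    exact ⟨q, q + 1, (by decide : ∀ q : Fin 3, q ≠ q + 1) q, h⟩

theorem sum_three (f : Fin (2 + 1) → ℕ) : ∑ q, f q = f 0 + f 1 + f 2 := Fin.sum_univ_three f

namespace Rep

variable {c : Code} {p : Position 3 2}

theorem nonempty_iff (h : Rep c p) : nonempty c = true ↔ ¬ p.HasEmptyColumn := by
  have hs : ∀ {Z : Type} [Fintype Z] (c : Z → Bool), ¬ stat c = 0 ↔ ∃ z, c z = true :=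
    fun c => stat_pos
  simp only [nonempty, Bool.and_eq_true, isFull_iff, val_any_q, val_anyI, h.m, h.l, h.r, h.t,
    Position.HasEmptyColumn, not_or, not_exists, hs]
  exact ⟨fun ⟨h1, h2, h3, h4⟩ => ⟨fun x y => h1 x y 0 0 true, fun x q => h2 x 0 0 q true,
      fun q x => h3 0 0 x q true, fun x y z => h4 x y z 0 true⟩,
    fun ⟨h1, h2, h3, h4⟩ => ⟨fun x y _ _ _ => h1 x y, fun x _ _ q _ => h2 x q,
      fun _ _ x q _ => h3 q x, fun x y z _ _ => h4 x y z⟩⟩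

theorem val_determined_iff (h : Rep c p) (x y z q : Fin 3) (i : Bool) :
    val (determined c.m) x y z q i = true ↔ p.m x y q = true ∧ stat (p.m x y) = 1 := by
  rw [and_congr_right fun e => stat_eq_one_iff _ q e]
  simp [val_determined, h.m]

theorem prodDone_iff (h : Rep c p) : prodDone c = true ↔ p.ProdDone := by
  simp only [prodDone, isFull_iff, val_any_q, h.val_determined_iff, Position.ProdDone]
  constructor
  · intro h x y
    obtain ⟨_, _, e⟩ := h x y 0 0 true
    exact e
  · intro h x y _ _ _
    obtain ⟨q, hq⟩ := stat_pos.1 (by rw [h x y]; exact one_ne_zero)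
    exact ⟨q, hq, h x y⟩

theorem profileDiff_iff (h : Rep c p) : isFull (profileDiff c) = true ↔ ¬ p.SameProfileB := by
  simp only [isFull_iff, profileDiff, val_any_x, val_any_z, val_anyI, val_lor, val_xor, val_compl,
    val_rot_q, val_flip, h.l, h.r, sameProfileB_iff]
  constructor
  · rintro H ⟨q, hq⟩
    obtain ⟨x, z, i, e⟩ := H 0 0 0 q true
    have hl := (hq x i).1
    have hr := (hq z i).2
    rw [← hl.1, ← hr.1] at e
    exact (by decide : ∀ a b c d : Bool, a ≠ b → c ≠ d →
      (a ^^ a || !(a ^^ b) || (c ^^ c || !(c ^^ d))) = true → False) _ _ _ _ hl.2 hr.2 e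
  · intro H x y z q i
    by_contra hno
    refine H ⟨q, fun x i => ?_⟩
    push Not at hno
    exact (by decide : ∀ a a' b c c' d : Bool,
      (a ^^ a' || !(a ^^ b) || (c ^^ c' || !(c ^^ d))) ≠ true →
      (a = a' ∧ a ≠ b) ∧ c = c' ∧ c ≠ d) _ _ _ _ _ _ (hno x x i)

theorem countOnes_l (h : Rep c p) :
    countOnes 54 (Nat.land c.l (compl (flip c.l))) = p.leftOnes := by
  have hv : ∀ x q : Fin 3, bit (Nat.land c.l (compl (flip c.l))) (idx x 0 0 q true) =
      if p.l x q true = true ∧ p.l x q false = false then 1 else 0 := by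
    intro x q
    have := val_land c.l (compl (flip c.l)) x 0 0 q true
    rw [val_compl, val_flip, h.l, h.l] at this
    rw [bit_eq]
    change (val _ _ _ _ _ _).toNat = _
    rw [this]
    cases p.l x q true <;> cases h' : p.l x q false <;> simp_all
  rw [Position.leftOnes, Finset.card_filter, Fintype.sum_prod_type, Fin.sum_univ_three]
  simp only [← hv]
  simp only [sum_three, countOnes, Nat.add_eq, ← add_assoc]
  rfl

theorem countOnes_r (h : Rep c p) :
    countOnes 6 (Nat.land c.r (compl (flip c.r))) = p.rightOnes := by
  have hv : ∀ q z : Fin 3, bit (Nat.land c.r (compl (flip c.r))) (idx 0 0 z q true) =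
      if p.r q z true = true ∧ p.r q z false = false then 1 else 0 := by
    intro q z
    have := val_land c.r (compl (flip c.r)) 0 0 z q true
    rw [val_compl, val_flip, h.r, h.r] at this
    rw [bit_eq]
    change (val _ _ _ _ _ _).toNat = _
    rw [this]
    cases p.r q z true <;> cases h' : p.r q z false <;> simp_all
  rw [Position.rightOnes, Finset.card_filter, Fintype.sum_prod_type_right, Fin.sum_univ_three]
  simp only [← hv]
  simp only [sum_three, countOnes, Nat.add_eq, ← add_assoc]
  rfl

theorem possible_iff (h : Rep c p) (hd : ¬ p.ProdDone) : possible c = true ↔ ¬ p.Impossible := by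
  have hA : ¬ p.SameProfileA := fun e => hd e.1
  simp only [possible, Bool.and_eq_true, h.nonempty_iff, h.profileDiff_iff, halfOnes, force_eq,
    Nat.ble_eq, h.countOnes_l, h.countOnes_r, Position.Impossible, not_or, not_lt, hA,
    not_false_eq_true, and_true]

end Rep

/-- The position is impossible or done. -/
def isLeaf (c : Code) : Bool := prodDone c || !(possible c)

theorem Rep.not_active {c : Code} {p : Position 3 2} (h : Rep c p) (hc : isLeaf c = true) :
    ¬ p.Active := by
  intro act
  have hd : ¬ p.ProdDone := fun e => act.2 ⟨act.1, e⟩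
  rw [isLeaf, Bool.or_eq_true, h.prodDone_iff, Bool.not_eq_true', Bool.eq_false_iff, Ne,
    h.possible_iff hd, not_not] at hc
  exact hc.elim hd act.1

/-! ### Processing and cuts of packed positions -/

/-- The codes are equal, including the labels. -/
def eqCode (c d : Code) : Bool :=
  Nat.beq c.m d.m && (Nat.beq c.t d.t && (Nat.beq c.r d.r && Nat.beq c.l d.l))

theorem eq_of_eqCode {c d : Code} (h : eqCode c d = true) : c = d := by
  simp only [eqCode, Bool.and_eq_true, Nat.beq_eq] at h
  obtain ⟨h1, h2, h3, h4⟩ := h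
  cases c; cases d
  simp_all

/-- Rounds of deductions until nothing changes, at most `n` times. -/
def close : ℕ → Code → Option Code
  | 0, _ => none
  | n + 1, c => match step c with
    | ⟨m, l, r, t⟩ => bif eqCode ⟨m, l, r, t⟩ c then some c else close n ⟨m, l, r, t⟩

theorem Rep.close {n : ℕ} {c c' : Code} {p : Position 3 2} (h : Rep c p)
    (hc : close n c = some c') : Rep c' p.process := by
  have key : ∀ (n : ℕ) (c : Code) (k : ℕ), Rep c (Position.step^[k] p) →
      Packed.close n c = some c' → Rep c' p.process := by
    intro n
    induction n with
    | zero => intro c k _ e; simp [Packed.close] at e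
    | succ n ih =>
      intro c k hk e
      change (bif eqCode (Packed.step c) c then some c else Packed.close n (Packed.step c)) = _ at e
      have hs := hk.step
      rw [← Function.iterate_succ_apply' Position.step] at hs
      cases he : eqCode (Packed.step c) c
      · rw [he, cond_false] at e
        exact ih _ (k + 1) hs e
      · rw [he, cond_true, Option.some_inj] at e
        subst e
        rw [eq_of_eqCode he] at hs
        rw [Position.process_eq_of_iterate
          ((Function.iterate_succ_apply' Position.step k p).symm.trans (hs.unique hk))]
        exact hk
  exact key n c 0 h hc

/-- The place of the first entry of the column of the mask of `μ` at `(x, y)`. -/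
def cellPlace (x y : Fin 3) : ℕ := Nat.add (Nat.add 27 (Nat.mul 54 x.val)) (Nat.mul 18 y.val)

/-- The part of a packed mask of `μ` which belongs to the column at `(0, 0)`; the column is given by
the number with binary digits `d`. The factor `12483 = 3 * (1 + 2 ^ 6 + 2 ^ 12)` repeats each entry
for all values of `z` and `i`. -/
def columnTensor (d : ℕ) : ℕ :=
  Nat.mul 12483 (Nat.add (Nat.land d 1)
    (Nat.add (Nat.mul 2 (Nat.land d 2)) (Nat.mul 4 (Nat.land d 4))))

/-- The code with the column of the mask of `μ` at `(x, y)` replaced by the one that determines `z`.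
It is not processed. -/
def cut (c : Code) (x y z : Fin 3) : Code :=
  force (cellPlace x y) fun s =>
  force (Nat.lor (Nat.land c.m (compl (Nat.shiftLeft (Nat.sub (Nat.pow 2 18) 1) s)))
    (Nat.shiftLeft (columnTensor (Nat.pow 2 z.val)) s)) fun m =>
  ⟨m, c.l, c.r, c.t⟩

theorem val_cell : ∀ x y x' y' z' q' i',
    val (Nat.shiftLeft (Nat.sub (Nat.pow 2 18) 1) (cellPlace x y)) x' y' z' q' i' =
      decide (x' = x ∧ y' = y) := by
  decide +kernel

theorem val_columnTensor : ∀ x y z x' y' z' q' i',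
    val (Nat.shiftLeft (columnTensor (Nat.pow 2 z.val)) (cellPlace x y)) x' y' z' q' i' =
      decide ((x' = x ∧ y' = y) ∧ q' = z) := by
  decide +kernel

theorem Rep.cut {n : ℕ} {c c' : Code} {p : Position 3 2} (h : Rep c p) {x y z : Fin 3}
    (hc : Packed.close n (cut c x y z) = some c') : Rep c' (p.cut x y z) := by
  refine Rep.close (c := Packed.cut c x y z) ⟨?_, h.l, h.r, h.t⟩ hc
  intro x' y' z' q' i'
  simp only [Packed.cut, force_eq, val_lor, val_land, val_compl, val_cell, val_columnTensor, h.m]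
  by_cases e : x' = x ∧ y' = y <;> simp [e]

/-! ### Columns of packed masks -/

/-- The column with first entry at the place `s`, as a number with base-four digits. -/
def column (N s : ℕ) : ℕ := Nat.land (Nat.shiftRight N s) 21

/-- A column as a number with base-four digits. -/
def columnCode (c : Fin 3 → Bool) : ℕ := (c 0).toNat + 4 * (c 1).toNat + 16 * (c 2).toNat

theorem Rep.column {c : Code} {p : Position 3 2} (h : Rep c p) (x y : Fin 3) :
    column c.m (cellPlace x y) = columnCode (p.m x y) := by
  have key : ∀ n < 32, n &&& 21 = (n.testBit 0).toNat + 4 * (n.testBit 2).toNat +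
      16 * (n.testBit 4).toNat := by decide +kernel
  have hm : ∀ q : Fin 3, p.m x y q = (c.m >>> cellPlace x y % 32).testBit (2 * q.val) := by
    intro q
    rw [← h.m x y 0 q false, Nat.testBit_mod_two_pow _ 5, Nat.testBit_shiftRight]
    have : 2 * q.val < 5 := by omega
    simp [this, val, idx, cellPlace]
  have h2 := key (c.m >>> cellPlace x y % 32) (Nat.mod_lt _ (by norm_num))
  rw [columnCode, hm, hm, hm]
  refine Eq.trans ?_ h2
  change (c.m >>> cellPlace x y) &&& 21 = _
  apply Nat.eq_of_testBit_eq
  intro j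
  rw [Nat.testBit_and, Nat.testBit_and, Nat.testBit_mod_two_pow _ 5]
  by_cases hj : j < 5
  · simp [hj]
  · have : Nat.testBit 21 j = false := Nat.testBit_lt_two_pow
      (lt_of_lt_of_le (by norm_num : 21 < 2 ^ 5) (Nat.pow_le_pow_right (by norm_num) (by omega)))
    simp [this]

/-- The column determines a value. -/
def isSingle (d : ℕ) : Bool := force d fun d => Nat.beq d 1 || (Nat.beq d 4 || Nat.beq d 16)

theorem isSingle_columnCode (c : Fin 3 → Bool) : isSingle (columnCode c) = true ↔ stat c = 1 := by
  revert c
  decide +kernel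

/-! ### Proofs given by their cuts -/

/-- The part of a proof below the value `z` of a cut, for a given way `next` to play proofs. -/
def playBelow (next : Code → List (Fin 3 × Fin 3) → Option (ℕ × List (Fin 3 × Fin 3)))
    (c : Code) (x y z : Fin 3) (cuts : List (Fin 3 × Fin 3)) : Option (ℕ × List (Fin 3 × Fin 3)) :=
  bif Nat.beq (bit c.m (idx x y 0 z false)) 0 then some (0, cuts) else
    match close 40 (cut c x y z) with
    | none => none
    | some c' => next c' cuts

/-- The number of passive nodes of the proof whose cuts are listed in depth-first order, and the
cuts that are left over; the first argument bounds the depth. -/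
def play : ℕ → Code → List (Fin 3 × Fin 3) → Option (ℕ × List (Fin 3 × Fin 3))
  | 0, _, _ => none
  | n + 1, c, cuts => bif isLeaf c then some (0, cuts) else match cuts with
    | [] => none
    | (x, y) :: cuts =>
      bif isSingle (column c.m (cellPlace x y)) then none else
      match playBelow (play n) c x y 0 cuts with
      | none => none
      | some (k₀, cuts) => match playBelow (play n) c x y 1 cuts with
        | none => none
        | some (k₁, cuts) => match playBelow (play n) c x y 2 cuts with
          | none => none
          | some (k₂, cuts) => some (1 + (k₀ + k₁ + k₂), cuts)

theorem Rep.atMost_of_playBelow {c : Code} {p : Position 3 2} (h : Rep c p)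
    {next : Code → List (Fin 3 × Fin 3) → Option (ℕ × List (Fin 3 × Fin 3))}
    (hn : ∀ {c p}, Rep c p → ∀ {cuts rest k}, next c cuts = some (k, rest) → p.AtMost k)
    {x y z : Fin 3} {cuts rest : List (Fin 3 × Fin 3)} {k : ℕ}
    (hk : playBelow next c x y z cuts = some (k, rest)) (hz : p.m x y z = true) :
    (p.cut x y z).AtMost k := by
  have hb : Nat.beq (bit c.m (idx x y 0 z false)) 0 = false := by
    have := h.m x y 0 z false
    rw [hz, val] at this
    rw [bit_eq, this]
    rfl
  rw [playBelow, hb, cond_false] at hk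
  split at hk
  · simp at hk
  · rename_i c' hc'
    exact hn (h.cut hc') hk

theorem Rep.atMost_of_play {n : ℕ} {c : Code} {p : Position 3 2} (h : Rep c p)
    {cuts rest : List (Fin 3 × Fin 3)} {k : ℕ} (hk : play n c cuts = some (k, rest)) :
    p.AtMost k := by
  induction n generalizing c p cuts rest k with
  | zero => simp [play] at hk
  | succ n ih =>
    cases hleaf : isLeaf c with
    | true => exact Position.atMost_of_not_active (h.not_active hleaf) _
    | false =>
    obtain _ | ⟨⟨x, y⟩, cuts⟩ := cuts
    · simp [play, hleaf] at hk
    cases hs : isSingle (Packed.column c.m (cellPlace x y)) with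
    | true => simp [play, hleaf, hs] at hk
    | false =>
    simp only [play, hleaf, hs, cond_false] at hk
    rw [isLeaf, Bool.or_eq_false_iff, Bool.not_eq_false'] at hleaf
    have hne : ¬ p.HasEmptyColumn := by
      have := hleaf.2
      rw [possible, Bool.and_eq_true] at this
      exact h.nonempty_iff.1 this.1
    rw [h.column, Bool.eq_false_iff, Ne, isSingle_columnCode] at hs
    have av : p.Available x y := by
      have : stat (p.m x y) ≠ 0 := fun e => hne (Or.inl ⟨x, y, e⟩)
      simp only [Position.Available]
      omega
    split at hk
    · simp at hk
    rename_i k₀ cuts₀ e₀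
    split at hk
    · simp at hk
    rename_i k₁ cuts₁ e₁
    split at hk
    · simp at hk
    rename_i k₂ cuts₂ e₂
    simp only [Option.some.injEq, Prod.mk.injEq] at hk
    have := Position.atMost_of_cut av ![k₀, k₁, k₂] fun z hz => by
      have hn := fun {c : Code} {p : Position 3 2} (h : Rep c p) {cuts rest k} =>
        @ih c p h cuts rest k
      change Fin 3 at z
      fin_cases z
      · exact h.atMost_of_playBelow hn e₀ hz
      · exact h.atMost_of_playBelow hn e₁ hz
      · exact h.atMost_of_playBelow hn e₂ hz
    rw [sum_three] at this
    exact hk.1 ▸ this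

/-! ### Tables of lower bounds -/

/-- The place of an entry of the mask of `μ` in a block of a table. -/
def cell (x y q : Fin 3) : ℕ := 18 * y.val + 6 * x.val + 2 * q.val

/-- The places of the entries with `x = 0`. -/
def rowMask : ℕ := Nat.mul 21 (Nat.add 1 (Nat.add (Nat.pow 2 18) (Nat.pow 2 36)))

/-- The entries of a packed mask of `μ`, moved to the even places among the first `54`. -/
def compact (N : ℕ) : ℕ :=
  Nat.lor (Nat.land (Nat.shiftRight N 27) rowMask)
    (Nat.lor (Nat.land (Nat.shiftRight N 75) (Nat.shiftLeft rowMask 6))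
      (Nat.land (Nat.shiftRight N 123) (Nat.shiftLeft rowMask 12)))

/-- The block all of whose digits are `1`. -/
def blockMask : ℕ := Nat.sub (Nat.pow 2 64) 1

/-- The block of `64` binary digits with number `k`. -/
def block (E k : ℕ) : ℕ := Nat.land (Nat.shiftRight E (Nat.mul 64 k)) blockMask

/-- A block that describes a lower bound `size` for proofs at a position with mask `m` of `μ`. The
even places belong to the entries of the mask, and each of them is followed by the corresponding
entry of the mask `d`. -/
def toBlock (m d size : ℕ) : ℕ :=
  Nat.land (Nat.lor (compact m) (Nat.lor (Nat.shiftLeft (compact d) 1) (Nat.shiftLeft size 55)))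
    blockMask

/-- A table of lower bounds. The blocks of `entries`, except for the one with number `0`, describe
bounds in descending order; `units` has the last digit of each of these blocks, and the digit number
`s` of `counts` in base `2 ^ 16` is the number of bounds of size at least `s`. The correctness of
bounds that are found by means of a table depends on `entries` only. -/
structure Table where
  entries : ℕ
  units : ℕ
  counts : ℕ

/-- Insert a block before the one with number `k`. -/
def insertBlock (E b k : ℕ) : ℕ :=
  Nat.lor (Nat.land E (Nat.sub (Nat.pow 2 (Nat.mul 64 k)) 1))
    (Nat.lor (Nat.shiftLeft b (Nat.mul 64 k))
      (Nat.shiftLeft (Nat.shiftRight E (Nat.mul 64 k)) (Nat.mul 64 (Nat.add k 1))))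

/-- Insert a block into a table, and pass the result on. -/
def Table.insert {α : Type} (T : Table) (b size : ℕ) (next : Table → α) : α :=
  force (Nat.add 1 (Nat.land
    (Nat.shiftRight T.counts (Nat.mul 16 size)) 65535)) fun k =>
  force (insertBlock T.entries b k) fun entries =>
  force (Nat.lor (Nat.shiftLeft T.units 64) (Nat.pow 2 64)) fun units =>
  force (Nat.add T.counts (Nat.div
    (Nat.sub (Nat.pow 2 (Nat.mul 16 (Nat.add size 1))) 1) 65535)) fun counts =>
  next ⟨entries, units, counts⟩

/-- The number `k` for which `2 ^ (64 * k)` is the lowest binary digit of `X`, not counting the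
block with number `0`; the other digits are assumed to be at multiples of `64`. -/
def lowestDigit (X : ℕ) : ℕ :=
  -- Modulo `2 ^ 64 - 1`, the quotient of `2 ^ (64 * k) - 1` and `2 ^ 64 - 1` is a sum of `k` ones.
  force X fun X => Nat.mod (Nat.div
    (Nat.sub (Nat.xor X (Nat.land X (Nat.sub X (Nat.pow 2 64)))) 1) blockMask) blockMask

/-- The size of the first block of `E`, among those whose last digit is in `good`, which has a `1`
at the place after `j` and is disjoint from `avoided`, or zero if such a block is not found. -/
def bestBound (E good avoided j : ℕ) : ℕ :=
  force (lowestDigit (Nat.land good (Nat.lor (Nat.shiftRight E (Nat.add j 1)) labelMask))) fun k =>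
  bif Nat.beq k 0 then 0 else
  force (block E k) fun b => force (Nat.shiftLeft 2 j) fun mark =>
  bif Nat.beq (Nat.land b (Nat.lor avoided mark)) mark then Nat.shiftRight b 55 else 0

/-- The bound for proofs which begin with a cut at the column with first place `j` in blocks. -/
def cutBound (E good avoided j : ℕ) : ℕ :=
  Nat.add 1 (Nat.add (Nat.add (bestBound E good avoided j) (bestBound E good avoided (Nat.add j 2)))
    (bestBound E good avoided (Nat.add j 4)))

/-- The minimum of `k` and of the bounds for the cuts available at the mask `m` of `μ`, for the
columns with the first places, in packed tensors and in blocks, from a list. -/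
def minCutBound (m E good avoided : ℕ) : List (ℕ × ℕ) → ℕ → ℕ
  | [], k => k
  | s :: ss, k => bif isSingle (column m s.1) then minCutBound m E good avoided ss k else
      force (cutBound E good avoided s.2) fun k' =>
        bif Nat.ble k k' then minCutBound m E good avoided ss k
        else minCutBound m E good avoided ss k'

/-- The first places of the nine columns, in packed tensors and in blocks. -/
def places : List (ℕ × ℕ) :=
  [(27, 0), (45, 18), (63, 36), (81, 6), (99, 24), (117, 42), (135, 12), (153, 30), (171, 48)]

/-- The bound for proofs at an open position with mask `m` of `μ` that follows from a table. The
value `1000` stands for an unlimited bound. -/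
def boundSize (m : ℕ) (T : Table) : ℕ :=
  force (Nat.land m labelMask) fun label =>
  force (Nat.lor T.entries label) fun E =>
  force (Nat.xor (compact full) (compact m)) fun avoided =>
  -- All blocks are compared at once: adding `2 ^ 54 - 1` to a number below `2 ^ 54` yields a digit
  -- `1` at the place `54` unless the number is zero.
  force (Nat.lor label (Nat.xor T.units (Nat.land T.units (Nat.shiftRight
    (Nat.add (Nat.land E (Nat.mul avoided T.units))
      (Nat.mul (Nat.sub (Nat.pow 2 54) 1) T.units)) 54)))) fun good =>
  minCutBound m E good avoided places 1000

/-- The block describes a valid bound at an open position below `p` with the mask of `φ` of `p`. -/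
def Describes (p : Position 3 2) (b : ℕ) : Prop :=
  ∃ q : Position 3 2, q.Open ∧ q.Le p ∧ q.l = p.l ∧ q.AtLeast (b >>> 55) ∧
    (∀ x y z, b.testBit (cell x y z) = q.m x y z) ∧
    ∀ x y z, b.testBit (cell x y z + 1) = true → q.m x y z = true ∧ stat (q.m x y) = 1

/-- All blocks of the table that are not zero describe valid bounds. -/
def Table.Valid (p : Position 3 2) (T : Table) : Prop :=
  ∀ k, block T.entries k = 0 ∨ Describes p (block T.entries k)

theorem testBit_rowMask : ∀ x y q : Fin 3,
    (rowMask.testBit (cell x y q) = decide (x = 0) ∧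
      (rowMask <<< 6).testBit (cell x y q) = decide (x = 1) ∧
      (rowMask <<< 12).testBit (cell x y q) = decide (x = 2)) := by
  decide +kernel

theorem testBit_rowMask_odd : ∀ j : Fin 27, rowMask.testBit (2 * j + 1) = false ∧
    (rowMask <<< 6).testBit (2 * j + 1) = false ∧ (rowMask <<< 12).testBit (2 * j + 1) = false := by
  decide +kernel

theorem testBit_compact_cell (N : ℕ) (x y q : Fin 3) :
    (compact N).testBit (cell x y q) = val N x y 0 q false := by
  change (N >>> 27 &&& rowMask ||| (N >>> 75 &&& rowMask <<< 6 |||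
    N >>> 123 &&& rowMask <<< 12)).testBit _ = _
  obtain ⟨h1, h2, h3⟩ := testBit_rowMask x y q
  simp only [Nat.testBit_or, Nat.testBit_and, Nat.testBit_shiftRight, h1, h2, h3, val]
  fin_cases x <;> simp [cell, idx] <;> congr 1 <;> omega

theorem testBit_compact_odd (N : ℕ) {j : ℕ} (hj : j < 27) :
    (compact N).testBit (2 * j + 1) = false := by
  change (N >>> 27 &&& rowMask ||| (N >>> 75 &&& rowMask <<< 6 |||
    N >>> 123 &&& rowMask <<< 12)).testBit _ = _
  obtain ⟨h1, h2, h3⟩ := testBit_rowMask_odd ⟨j, hj⟩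
  simp only at h1 h2 h3
  simp only [Nat.testBit_or, Nat.testBit_and, h1, h2, h3, Bool.and_false, Bool.or_false]

theorem compact_lt (N : ℕ) : compact N < 2 ^ 54 :=
  Nat.or_lt_two_pow (Nat.and_lt_two_pow _ (by decide +kernel))
    (Nat.or_lt_two_pow (Nat.and_lt_two_pow _ (by decide +kernel))
      (Nat.and_lt_two_pow _ (by decide +kernel)))

theorem testBit_toBlock (m d size : ℕ) {j : ℕ} (hj : j < 54) : (toBlock m d size).testBit j =
    ((compact m).testBit j || decide (1 ≤ j) && (compact d).testBit (j - 1)) := by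
  change ((compact m ||| (compact d <<< 1 ||| size <<< 55)) &&& (2 ^ 64 - 1)).testBit j = _
  have h1 : ¬ 55 ≤ j := by omega
  have h2 : j < 64 := by omega
  rw [Nat.testBit_and, Nat.testBit_two_pow_sub_one, decide_eq_true h2, Bool.and_true]
  simp [Nat.testBit_shiftLeft, h1]

theorem toBlock_shiftRight_le (m d size : ℕ) : toBlock m d size >>> 55 ≤ size := by
  change ((compact m ||| (compact d <<< 1 ||| size <<< 55)) &&& (2 ^ 64 - 1)) >>> 55 ≤ size
  have h1 : compact m >>> 55 = 0 := Nat.shiftRight_eq_zero _ _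
    ((compact_lt m).trans (by norm_num))
  have h2 : (compact d <<< 1) >>> 55 = 0 := Nat.shiftRight_eq_zero _ _ (by
    rw [Nat.shiftLeft_eq]
    have := compact_lt d
    omega)
  rw [Nat.shiftRight_and_distrib, Nat.shiftRight_or_distrib, Nat.shiftRight_or_distrib, h1, h2,
    Nat.zero_or, Nat.zero_or, Nat.shiftLeft_shiftRight]
  exact Nat.and_le_left

theorem testBit_block (E k i : ℕ) :
    (block E k).testBit i = (E.testBit (64 * k + i) && decide (i < 64)) := by
  change ((E >>> (64 * k)) &&& (2 ^ 64 - 1)).testBit i = _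
  rw [Nat.testBit_and, Nat.testBit_shiftRight, Nat.testBit_two_pow_sub_one]

theorem block_insertBlock {E b : ℕ} (hb : b < 2 ^ 64) (k n : ℕ) :
    block (insertBlock E b k) n = b ∨ ∃ n', block (insertBlock E b k) n = block E n' := by
  have key : ∀ j, (insertBlock E b k).testBit j = ((E.testBit j && decide (j < 64 * k)) ||
      (decide (64 * k ≤ j) && b.testBit (j - 64 * k) ||
        decide (64 * (k + 1) ≤ j) && E.testBit (64 * k + (j - 64 * (k + 1))))) := by
    intro j
    change ((E &&& (2 ^ (64 * k) - 1)) ||| (b <<< (64 * k) |||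
      (E >>> (64 * k)) <<< (64 * (k + 1)))).testBit j = _
    simp only [Nat.testBit_or, Nat.testBit_and, Nat.testBit_two_pow_sub_one, Nat.testBit_shiftLeft,
      Nat.testBit_shiftRight, ge_iff_le]
  rcases lt_trichotomy n k with h | rfl | h
  · refine Or.inr ⟨n, Nat.eq_of_testBit_eq fun i => ?_⟩
    rw [testBit_block, testBit_block, key]
    by_cases hi : i < 64
    · have h1 : 64 * n + i < 64 * k := by omega
      have h2 : ¬ 64 * k ≤ 64 * n + i := by omega
      have h3 : ¬ 64 * (k + 1) ≤ 64 * n + i := by omega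
      simp [h1, h2, h3]
    · simp [hi]
  · refine Or.inl (Nat.eq_of_testBit_eq fun i => ?_)
    rw [testBit_block, key]
    by_cases hi : i < 64
    · have h3 : ¬ 64 * (n + 1) ≤ 64 * n + i := by omega
      simp [h3, hi]
    · rw [decide_eq_false hi, Bool.and_false]
      exact (Nat.testBit_lt_two_pow (hb.trans_le (Nat.pow_le_pow_right (by norm_num)
        (by omega)))).symm
  · refine Or.inr ⟨n - 1, Nat.eq_of_testBit_eq fun i => ?_⟩
    rw [testBit_block, testBit_block, key]
    by_cases hi : i < 64
    · have h1 : ¬ 64 * n + i < 64 * k := by omega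
      have h2 : 64 * (k + 1) ≤ 64 * n + i := by omega
      have h3 : 64 * k + (64 * n + i - 64 * (k + 1)) = 64 * (n - 1) + i := by omega
      have h4 : b.testBit (64 * n + i - 64 * k) = false := Nat.testBit_lt_two_pow
        (hb.trans_le (Nat.pow_le_pow_right (by norm_num) (by omega)))
      rw [h3, h4]
      simp [h1, h2]
    · simp [hi]

theorem toBlock_lt (m d size : ℕ) : toBlock m d size < 2 ^ 64 :=
  Nat.and_lt_two_pow _ (by decide +kernel)

theorem Table.Valid.exists_insert_eq {p : Position 3 2} {T : Table} (hT : T.Valid p)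
    {b : ℕ} (hb : b < 2 ^ 64) (hd : Describes p b) (size : ℕ) {α : Type} (next : Table → α) :
    ∃ T' : Table, T'.Valid p ∧ T.insert b size next = next T' := by
  simp only [Table.insert, force_eq]
  refine ⟨_, fun n => ?_, rfl⟩
  rcases block_insertBlock hb (E := T.entries) _ n with h | ⟨n', h⟩
  · exact Or.inr (h.symm ▸ hd)
  · exact h.symm ▸ hT n'

theorem exists_block_of_bestBound {E good avoided j : ℕ} (h : bestBound E good avoided j ≠ 0) :
    ∃ k, k ≠ 0 ∧ bestBound E good avoided j = block E k >>> 55 ∧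
      Nat.land (block E k) (Nat.lor avoided (Nat.shiftLeft 2 j)) = Nat.shiftLeft 2 j := by
  simp only [bestBound, force_eq] at h ⊢
  generalize lowestDigit
    (Nat.land good (Nat.lor (Nat.shiftRight E (Nat.add j 1)) labelMask)) = k at h ⊢
  cases hk : Nat.beq k 0
  · rw [hk, cond_false] at h
    cases hb : Nat.beq (Nat.land (block E k) (Nat.lor avoided (Nat.shiftLeft 2 j)))
      (Nat.shiftLeft 2 j)
    · rw [hb] at h
      exact absurd rfl h
    · exact ⟨k, fun e => by simp [e] at hk, rfl, Nat.eq_of_beq_eq_true hb⟩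
  · rw [hk] at h
    exact absurd rfl h

theorem cutBound_cell (E good avoided : ℕ) (x y : Fin 3) :
    cutBound E good avoided (cell x y 0) = 1 + (bestBound E good avoided (cell x y 0) +
      bestBound E good avoided (cell x y 1) + bestBound E good avoided (cell x y 2)) := by
  have h1 : Nat.add (cell x y 0) 2 = cell x y 1 := rfl
  have h2 : Nat.add (cell x y 0) 4 = cell x y 2 := rfl
  rw [cutBound, h1, h2]
  simp only [Nat.add_eq]

theorem minCutBound_le {m E good avoided : ℕ} {ss : List (ℕ × ℕ)} {k : ℕ} :
    minCutBound m E good avoided ss k ≤ k ∧ ∀ s ∈ ss, isSingle (column m s.1) = false →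
      minCutBound m E good avoided ss k ≤ cutBound E good avoided s.2 := by
  induction ss generalizing k with
  | nil => simp [minCutBound]
  | cons s ss ih =>
    rw [minCutBound]
    have h1 := ih (k := k)
    have h2 := ih (k := cutBound E good avoided s.2)
    simp only [force_eq, List.mem_cons, forall_eq_or_imp]
    cases hs : isSingle (column m s.1)
    · rw [cond_false]
      cases hk : Nat.ble k (cutBound E good avoided s.2)
      · have : ¬ k ≤ cutBound E good avoided s.2 := fun e => by
          rw [Nat.ble_eq_true_of_le e] at hk
          exact Bool.noConfusion hk
        simp only [cond_false]
        exact ⟨by omega, fun _ => h2.1, h2.2⟩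
      · rw [Nat.ble_eq] at hk
        simp only [cond_true]
        exact ⟨h1.1, fun _ => by omega, h1.2⟩
    · simp only [cond_true]
      exact ⟨h1.1, by simp, h1.2⟩

theorem testBit_labelMask (j : ℕ) : labelMask.testBit j = decide (j < 27) :=
  Nat.testBit_two_pow_sub_one 27 j

/-- Labels affect only the block with number `0`. -/
theorem block_lor_label (E m : ℕ) {k : ℕ} (hk : k ≠ 0) :
    block (Nat.lor E (Nat.land m labelMask)) k = block E k := by
  apply Nat.eq_of_testBit_eq
  intro i
  rw [testBit_block, testBit_block]
  change ((E ||| (m &&& labelMask)).testBit _ && _) = _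
  have : ¬ 64 * k + i < 27 := by omega
  rw [Nat.testBit_or, Nat.testBit_and, testBit_labelMask, decide_eq_false this, Bool.and_false,
    Bool.or_false]

theorem cell_lt (x y z : Fin 3) : cell x y z < 53 := by
  simp only [cell]
  omega

/-- The bound read off a table is valid. The positions in the table are compared with `q` by means
of their masks of `μ` only. This suffices if `q` is the largest stable position below the root
within its mask of `μ`, that is, if it results from processing the root with a smaller mask of `μ`.
-/
theorem describes_toBlock {root q : Position 3 2} {T : Table} (hT : T.Valid root) {c : Code}
    (hc : Rep c q) (hq : q.Open) (hle : q.Le root) (hl : q.l = root.l)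
    (hmax : ∀ q' : Position 3 2, q'.Open → q'.Le root →
      (∀ x y z, q'.m x y z = true → q.m x y z = true) → q'.Le q) :
    Describes root (toBlock c.m (determined c.m) (boundSize c.m T)) := by
  have hm : ∀ x y z, (compact c.m).testBit (cell x y z) = q.m x y z := fun x y z => by
    rw [testBit_compact_cell, hc.m]
  refine ⟨q, hq, hle, hl, ?_, fun x y z => ?_, fun x y z h => ?_⟩
  · have mono : ∀ {k k' : ℕ}, q.AtLeast k' → k ≤ k' → q.AtLeast k := fun h hk p hp hl T hT =>
      hk.trans (h p hp hl T hT)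
    refine mono ?_ (toBlock_shiftRight_le _ _ _)
    refine hq.atLeast fun x y av => ?_
    have hs : isSingle (column c.m (cellPlace x y)) = false := by
      rw [hc.column, Bool.eq_false_iff, Ne, isSingle_columnCode]
      simp only [Position.Available] at av
      omega
    have hp : (cellPlace x y, cell x y 0) ∈ places :=
      (by decide : ∀ x y, (cellPlace x y, cell x y 0) ∈ places) x y
    simp only [boundSize, force_eq]
    generalize Nat.lor (Nat.land c.m labelMask) _ = good
    refine ⟨fun z => bestBound (Nat.lor T.entries (Nat.land c.m labelMask)) good
      (Nat.xor (compact full) (compact c.m)) (cell x y z), ?_, fun z hz => ?_⟩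
    · rw [sum_three, ← cutBound_cell]
      exact minCutBound_le.2 (cellPlace x y, cell x y 0) hp hs
    · obtain ⟨k, hk, hbound, hb⟩ := exists_block_of_bestBound hz
      rw [block_lor_label _ _ hk] at hbound hb
      simp only [hbound] at hz ⊢
      rcases hT k with h0 | ⟨q', ho, hle', hl', hsize, hm', hd'⟩
      · rw [h0] at hz
        exact absurd rfl hz
      have hb' : ∀ j, ((block T.entries k).testBit j && ((((compact full).testBit j ^^
          (compact c.m).testBit j)) || (2 <<< cell x y z).testBit j)) =
            (2 <<< cell x y z).testBit j := by
        intro j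
        have := congrArg (fun n => n.testBit j) hb
        change (block T.entries k &&& ((compact full ^^^ compact c.m) |||
          2 <<< cell x y z)).testBit j = (2 <<< cell x y z).testBit j at this
        rwa [Nat.testBit_and, Nat.testBit_or, Nat.testBit_xor] at this
      have hmark : ∀ j, (2 <<< cell x y z).testBit j = decide (j = cell x y z + 1) := by
        intro j
        rw [show 2 <<< cell x y z = 2 ^ (cell x y z + 1) by
          rw [Nat.shiftLeft_eq, pow_succ, mul_comm], Nat.testBit_two_pow]
        exact decide_eq_decide.2 eq_comm
      have hdet := hd' x y z (by
        have := hb' (cell x y z + 1)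
        rw [hmark, decide_eq_true rfl, Bool.and_eq_true] at this
        exact this.1)
      obtain ⟨z₀, hz₀⟩ := stat_eq_one.1 hdet.2
      refine ⟨q', ho, hmax q' ho hle' fun x' y' z' e => ?_, hl'.trans hl.symm, fun z' h => ?_,
        hsize⟩
      · have := hb' (cell x' y' z')
        have hne : cell x' y' z' ≠ cell x y z + 1 := by
          simp only [cell]
          omega
        rw [hmark, decide_eq_false hne, hm', e, testBit_compact_cell, val_full, hm] at this
        simpa using this
      · rw [(hz₀ z').1 h, (hz₀ z).1 hdet.1]
  · have h1 := cell_lt x y z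
    rw [testBit_toBlock _ _ _ (by omega), hm]
    rcases Nat.eq_zero_or_pos (cell x y z) with h0 | h0
    · simp [h0]
    · have : cell x y z - 1 = 2 * (9 * y.val + 3 * x.val + z.val - 1) + 1 := by
        simp only [cell] at h0 ⊢
        omega
      rw [this, testBit_compact_odd _ (by omega), Bool.and_false, Bool.or_false]
  · have h1 := cell_lt x y z
    rw [testBit_toBlock _ _ _ (by omega), Nat.add_sub_cancel, testBit_compact_cell] at h
    have : cell x y z + 1 = 2 * (9 * y.val + 3 * x.val + z.val) + 1 := by
      simp only [cell]
      omega
    rw [this, testBit_compact_odd _ (by omega), Bool.false_or, Bool.and_eq_true] at h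
    exact (hc.val_determined_iff x y 0 z false).1 h.2

/-! ### Packed root positions -/

/-- The packed form of a tensor with five indices. -/
def pack (f : Fin 3 → Fin 3 → Fin 3 → Fin 3 → Bool → Bool) : ℕ :=
  Nat.lor labelMask (Nat.shiftLeft (Nat.ofBits fun j : Fin 162 =>
    f (Fin.ofNat 3 (j / 54)) (Fin.ofNat 3 (j / 18)) (Fin.ofNat 3 (j / 6)) (Fin.ofNat 3 (j / 2))
      (Nat.beq (j % 2) 1)) 27)

theorem val_pack (f : Fin 3 → Fin 3 → Fin 3 → Fin 3 → Bool → Bool) (x y z q i) :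
    val (pack f) x y z q i = f x y z q i := by
  obtain ⟨h1, h2⟩ := idx_bounds x y z q i
  have hi := i.toNat_lt
  rw [pack, val_lor, val_labelMask, Bool.false_or, val_shiftLeft, decide_eq_true h1, Bool.true_and,
    Nat.testBit_ofBits_lt _ _ h2]
  simp only
  congr 1
  · ext; simp only [Fin.val_ofNat, idx]; omega
  · ext; simp only [Fin.val_ofNat, idx]; omega
  · ext; simp only [Fin.val_ofNat, idx]; omega
  · ext; simp only [Fin.val_ofNat, idx]; omega
  · have : (idx x y z q i - 27) % 2 = i.toNat := by simp only [idx]; omega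
    simp only [this]
    cases i <;> rfl

/-- The packed form of a position. -/
def encode (p : Position 3 2) : Code :=
  ⟨pack fun x y _ q _ => p.m x y q, pack fun x _ _ q i => p.l x q i,
    pack fun _ _ z q i => p.r q z i, pack fun x y z _ i => p.t x y z i⟩

theorem rep_encode (p : Position 3 2) : Rep (encode p) p :=
  ⟨val_pack fun x y _ q _ => p.m x y q, val_pack fun x _ _ q i => p.l x q i,
    val_pack fun _ _ z q i => p.r q z i, val_pack fun x y z _ i => p.t x y z i⟩

/-- Evaluation of the fields of a code before it is passed on. -/
def forceCode {α : Type} (c : Code) (f : Code → α) : α :=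
  force c.m fun m => force c.l fun l => force c.r fun r => force c.t fun t => f ⟨m, l, r, t⟩

/-! ### Families of masks -/

/-- A packed mask of `μ` with only one nonempty column, the one of number `n`, given by the binary
digits of `d`. The label tells the masks of a family apart. -/
def piece (d n : ℕ) : ℕ :=
  Nat.lor (Nat.shiftLeft (columnTensor d) (Nat.add (Nat.mul 18 n) 27))
    (Nat.shiftLeft d (Nat.mul 3 n))

/-- Bounds for a family of masks of `μ`. The masks agree with `N`, except for the first `n` columns,
each of which is equal to the corresponding column of one of two masks; these are given by decimal
digits, one for each column, and the binary digits of such a digit are the entries of the column.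
Each mask, together with the other masks from `start`, is closed under deductions, and if the result
is open and has the mask of `φ` from `start`, the bound that follows from the table is added to the
table. The table is passed on. -/
def explore {α : Type} (start : Code) : ℕ → ℕ → ℕ → ℕ → Table → (Table → α) → α
  | 0, _, _, N, T, next => force (any 6 (anyI N)) fun N =>
      match close 40 ⟨N, start.l, start.r, start.t⟩ with
      | none => next T
      | some c => bif Nat.beq (Nat.land full c.l) (Nat.land full start.l) && !(isLeaf c) then
          force (boundSize c.m T) fun size => force (toBlock c.m (determined c.m) size) fun b =>
            T.insert b size next
        else next T
  | n + 1, lo, hi, N, T, next =>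
      force (Nat.mod lo 10) fun d => force (Nat.mod hi 10) fun d' =>
      force (Nat.div lo 10) fun lo => force (Nat.div hi 10) fun hi =>
      force (Nat.lor N (piece d n)) fun N' => explore start n lo hi N' T fun T =>
      bif Nat.beq d d' then next T else
      force (Nat.lor N (piece d' n)) fun N' => explore start n lo hi N' T next

/-- Bounds for a list of families of masks, each using those for the families before. -/
def exploreAll {α : Type} (start : Code) : List (ℕ × ℕ) → Table → (Table → α) → α
  | [], T, next => next T
  | f :: fs, T, next => explore start 9 f.1 f.2 0 T fun T => exploreAll start fs T next

theorem exists_explore_eq {start : Code} {p : Position 3 2} (hs : Rep start p)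
    (hp : ∀ x y z, p.m x y z = true) {α : Type} (n lo hi N : ℕ) {T : Table} (hT : T.Valid p)
    (next : Table → α) :
    ∃ T' : Table, T'.Valid p ∧ explore start n lo hi N T next = next T' := by
  induction n generalizing lo hi N T next with
  | zero =>
    rw [explore]
    simp only [force_eq]
    split
    · exact ⟨T, hT, rfl⟩
    rename_i c hc
    cases hl : Nat.beq (Nat.land full c.l) (Nat.land full start.l) && !(isLeaf c)
    · exact ⟨T, hT, rfl⟩
    rw [cond_true]
    have h0 : Rep ⟨any 6 (anyI N), start.l, start.r, start.t⟩
        { p with m := fun x y q => val (any 6 (anyI N)) x y 0 q true } := by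
      refine ⟨fun x y z q i => ?_, hs.l, hs.r, hs.t⟩
      rw [Bool.eq_iff_iff]
      simp only [val_any_z, val_anyI]
    have h1 := h0.close hc
    rw [Bool.and_eq_true, Nat.beq_eq, Bool.not_eq_true', isLeaf, Bool.or_eq_false_iff,
      Bool.not_eq_false', Bool.eq_false_iff, Ne, h1.prodDone_iff] at hl
    have hi := (h1.possible_iff hl.2.1).1 hl.2.2
    have hle := Position.process_le
      { p with m := fun x y q => val (any 6 (anyI N)) x y 0 q true }
    refine hT.exists_insert_eq (toBlock_lt _ _ _) (describes_toBlock hT h1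
      ⟨⟨Position.step_process _, fun e => hi (Or.inl e)⟩, hi, hl.2.1⟩
      ⟨fun x y z _ => hp x y z, hle.l, hle.r, hle.t⟩ ?_ fun q' ho h h' => ?_) _ _
    · funext x q i
      rw [← h1.l x 0 0 q i, ← hs.l x 0 0 q i]
      exact val_eq_of_land_full_eq hl.1 _ _ _ _ _
    · exact ho.toStable.le_process ⟨fun x y z e => hle.m x y z (h' x y z e), h.l, h.r, h.t⟩
  | succ n ih =>
    simp only [explore, force_eq]
    obtain ⟨T', hT', e⟩ := ih (Nat.div lo 10) (Nat.div hi 10) _ hT _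
    rw [e]
    cases hd : Nat.beq (Nat.mod lo 10) (Nat.mod hi 10)
    · exact ih _ _ _ hT' next
    · exact ⟨T', hT', rfl⟩

theorem exists_exploreAll_eq {start : Code} {p : Position 3 2} (hs : Rep start p)
    (hp : ∀ x y z, p.m x y z = true) {α : Type} (families : List (ℕ × ℕ)) {T : Table}
    (hT : T.Valid p) (next : Table → α) :
    ∃ T' : Table, T'.Valid p ∧ exploreAll start families T next = next T' := by
  induction families generalizing T with
  | nil => exact ⟨T, hT, rfl⟩
  | cons f families ih =>
    obtain ⟨T', hT', e⟩ := exists_explore_eq hs hp 9 f.1 f.2 0 hT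
      fun T => exploreAll start families T next
    rw [exploreAll, e]
    exact ih hT'

/-- The masks of a list of families lead to the lower bound `k` at the root of the instance `σ`. -/
def certifies (σ : Fin 13) (families : List (ℕ × ℕ)) (k : ℕ) : Bool :=
  forceCode (encode (root σ)) fun start => exploreAll start families ⟨0, 0, 0⟩ fun T =>
    Nat.ble k (Nat.shiftRight (block T.entries 1) 55)

theorem le_numPassive_of_certifies {σ : Fin 13} {families : List (ℕ × ℕ)} {k : ℕ}
    (h : certifies σ families k = true) (T : ProofTree (root σ)) (hT : T.Complete) :
    k ≤ T.numPassive := by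
  have hr := rep_encode (root σ)
  rw [certifies] at h
  generalize encode (root σ) = start at h hr
  simp only [forceCode, force_eq] at h
  obtain ⟨T', hT', e⟩ := exists_exploreAll_eq hr (fun _ _ _ => rfl) families
    (T := ⟨0, 0, 0⟩) (fun n => Or.inl (Nat.eq_of_testBit_eq fun i => by simp [testBit_block]))
    fun T => Nat.ble k (Nat.shiftRight (block T.entries 1) 55)
  rw [e] at h
  refine (Nat.le_of_ble_eq_true h).trans ?_
  rcases hT' 1 with h0 | ⟨q, -, hle, hl, hb, -⟩
  · rw [h0]
    exact Nat.zero_le _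
  · exact hb _ hle hl T hT

/-! ### Lists of cuts -/

/-- A list of cuts from the decimal digits of a number: the cut at `(x, y)` has the digit
`3 * x + y + 1`. The first argument bounds the number of digits. -/
def cutList : ℕ → ℕ → List (Fin 3 × Fin 3) → List (Fin 3 × Fin 3)
  | 0, _, acc => acc
  | n + 1, k, acc => bif Nat.beq k 0 then acc else
    cutList n (Nat.div k 10) ((Fin.ofNat 3 (Nat.div (Nat.sub (Nat.mod k 10) 1) 3),
      Fin.ofNat 3 (Nat.sub (Nat.mod k 10) 1)) :: acc)

/-- The cuts with the given digits are those of a proof of size at most `n` for the instance `σ`. -/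
def proves (σ : Fin 13) (cuts n : ℕ) : Bool :=
  forceCode (encode (root σ)) fun start =>
    match play 10 start (cutList 40 cuts []) with
    | none => false
    | some (k, _) => Nat.ble k n

theorem atMost_of_proves {σ : Fin 13} {cuts n : ℕ} (h : proves σ cuts n = true) :
    (root σ).AtMost n := by
  have hr := rep_encode (root σ)
  rw [proves] at h
  generalize encode (root σ) = start at h hr
  simp only [forceCode, force_eq] at h
  split at h
  · simp at h
  · rename_i k _ hk
    obtain ⟨T, hT, hn⟩ := hr.atMost_of_play hk
    exact ⟨T, hT, hn.trans (Nat.le_of_ble_eq_true h)⟩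

theorem isLeast_proofSizes {σ : Fin 13} {families : List (ℕ × ℕ)} {cuts n : ℕ}
    (h : certifies σ families n = true) (h' : proves σ cuts n = true) :
    IsLeast (proofSizes (root σ)) n := by
  obtain ⟨T, hT, hn⟩ := atMost_of_proves h'
  refine ⟨⟨T, hT, le_antisymm hn (le_numPassive_of_certifies h T hT)⟩, ?_⟩
  rintro _ ⟨T, hT, rfl⟩
  exact le_numPassive_of_certifies h T hT

/-! ### The minimal sizes for the thirteen instances -/

theorem isLeast_root_0 : IsLeast (proofSizes (root 0)) 9 :=
  isLeast_proofSizes (cuts := 123456789) (families := [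
    (444444444, 655665655)])
    (by decide +kernel) (by decide +kernel)

theorem isLeast_root_1 : IsLeast (proofSizes (root 1)) 21 :=
  isLeast_proofSizes (cuts := 415635636323718989931) (families := [
    (124446444, 124446444), (125444464, 125446464), (126444444, 126444444), (161444464, 161444464),
    (162444444, 162444444), (142444446, 162444446), (254444444, 254444444), (245444444, 255444444),
    (411446446, 411446446), (411464464, 411464464), (414446444, 414446444), (414464444, 414464444),
    (414624444, 414624444), (414642444, 414642444), (414462444, 414662444), (441444426, 441444426),
    (441444446, 441444446), (441444464, 441444464), (441444642, 441444642), (516442444, 516662444),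
    (116446444, 516446464), (124464444, 326464444), (124644444, 126644446), (142444464, 552444464),
    (152446444, 152446464), (142444644, 162464644), (146444444, 146464446), (146444464, 156444464),
    (146444644, 146464644), (156446444, 156446464), (164444444, 165446464), (164464444, 164464444),
    (544444444, 564464444), (146444444, 566464446), (142444644, 166464644), (124644444, 166644446),
    (344444444, 366444446), (341444244, 347444644), (124464444, 366464444), (314244444, 374644444),
    (414264444, 714264444), (414246444, 714266444), (415244644, 715266644), (441444264, 741444264),
    (441444246, 741444266), (451644244, 751644266), (367444644, 767464644), (376644444, 776644446),
    (411644644, 711646646), (411664664, 711664664), (414426444, 414626444), (414466444, 414466444),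
    (516466444, 516466444), (454444444, 556466444), (142444464, 556444464), (116446444, 556446464),
    (414644444, 756666444), (415442446, 715646446), (756644464, 756646464), (376644444, 776664446),
    (415424464, 415666464), (715664464, 715664464), (415644644, 715646646), (415664644, 717664644),
    (415664664, 415664664), (415666644, 715666644), (415424464, 415666664), (441444462, 441444662),
    (441444466, 441444466), (561444424, 561444466), (441444624, 561444626), (445444444, 565444466),
    (164444444, 565446464), (441444644, 765444666), (451464424, 751464664), (765446644, 765446664),
    (367444644, 767464646), (577464464, 777464666), (451446442, 455446662), (577446446, 777666446),
    (451446446, 451446666), (751446646, 751446646), (451644644, 751646646), (451644664, 451666666),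
    (455444444, 755464464), (555444444, 555464464), (455444446, 755444446), (455444466, 455444466),
    (455444644, 755464664), (455444646, 455444646), (455446444, 755446446), (555444444, 555446446),
    (455444444, 755646646), (451446442, 455446666), (571446466, 775446666), (751644664, 771646666),
    (455466444, 455466644), (455644464, 755644664), (455644666, 455664666), (455646666, 455646666),
    (775644464, 775646666), (455664444, 755664644), (455466444, 455666644), (455664464, 755664464),
    (455666466, 455666466), (451644664, 455666666), (411664664, 755664664), (517466464, 757666464),
    (577466466, 577466466), (717646644, 717666664), (757446644, 757666664), (777664464, 777666466),
    (777644644, 777664666), (777446646, 777666666)])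
    (by decide +kernel) (by decide +kernel)

theorem isLeast_root_2 : IsLeast (proofSizes (root 2)) 23 :=
  isLeast_proofSizes (cuts := 74899829932412561251652) (families := [
    (112112644, 112112644), (112112464, 112112664), (116116444, 116116664), (112112446, 116116446),
    (126144444, 126144444), (132156444, 132156666), (143144444, 143144444), (142145446, 143145446),
    (162144444, 162144444), (225224444, 225224444), (224225444, 225225444), (316312444, 316312664),
    (316312446, 316312446), (344144444, 344144444), (146144444, 346144444), (414216444, 414216444),
    (414416444, 414416444), (414612444, 414612444), (441441246, 441441246), (441441264, 441441264),
    (441441426, 441441426), (441441462, 441441462), (441441622, 441441622), (441441624, 441441624),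
    (441441642, 441441642), (441441644, 441441644), (441441262, 441441662), (644144444, 644144444),
    (124164444, 126164444), (124324444, 125324444), (124364444, 126364444), (164144444, 166364444),
    (324124444, 326364444), (134124444, 336164444), (124324444, 335324444), (124164444, 136364444),
    (136176444, 136376446), (136176644, 136376666), (336176444, 336176446), (124164444, 366164444),
    (214234444, 215235444), (214314444, 214334444), (234214444, 234616444), (234234444, 235235444),
    (214314444, 234334444), (614214444, 634316444), (614234444, 614336444), (414614444, 614636444),
    (234214444, 634616444), (214234444, 635235444), (634236444, 634236444), (716316444, 716316664),
    (716316444, 716336446), (716336464, 716336464), (736316444, 736316446), (341541244, 741541644),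
    (441441226, 441441626), (451431424, 451471626), (441441464, 451471664), (341541244, 741541664),
    (441441266, 441441266), (441441446, 441441666), (741541246, 741541666), (444445444, 444445644),
    (544444444, 544445444), (444544444, 566545444), (444454444, 544456444), (454444444, 454656444),
    (445444444, 455454444), (444445444, 455455644), (445445464, 445455664), (455445464, 455445664),
    (444554444, 546554444), (554444444, 554444444), (444454444, 554456444), (444544444, 645545444),
    (445445444, 645545466), (445445646, 445445666), (445545644, 445545664), (445455446, 455655646),
    (455477464, 455477666), (747545644, 747545666), (774774444, 776776446), (777777644, 777777646),
    (777777464, 777777666)])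
    (by decide +kernel) (by decide +kernel)

theorem isLeast_root_3 : IsLeast (proofSizes (root 3)) 37 :=
  isLeast_proofSizes (cuts := 1237894536633624356637834656362788936) (families := [
    (112112312, 112112312), (112112132, 112112332), (112112116, 112112336), (116116114, 116116336),
    (121321121, 121321121), (121161121, 121361121), (121123121, 121363121), (123145163, 123145163),
    (126144144, 126144144), (132122122, 132122122), (122123123, 132123123), (122132132, 122133133),
    (132136154, 132136154), (161141161, 161363161), (162144144, 162144144), (212312212, 212312212),
    (213212213, 213312213), (221221321, 221221321), (231211211, 231211211), (231231221, 231231321),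
    (234234114, 234234114), (243141243, 243141243), (246145346, 246145346), (264364154, 264364154),
    (312212312, 313212313), (313663323, 313663323), (316312514, 316312514), (323366313, 323366313),
    (324324114, 324324114), (321321221, 331331221), (331332636, 331332636), (332331366, 332331366),
    (342141342, 342141342), (344144144, 344144144), (361541321, 361541321), (164144144, 364144144),
    (146144144, 366144144), (142145146, 366145346), (124164154, 366364154), (411423423, 411423423),
    (411432432, 411432432), (414216414, 414216414), (414612414, 414612414), (414614414, 414614414),
    (414434414, 414634414), (414416414, 414636414), (415426436, 415426436), (415412416, 415636436),
    (441441461, 441441461), (441441621, 441441621), (441441641, 441441641), (441441261, 441441661),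
    (441441443, 441441663), (451463462, 451463462), (451461421, 451463663), (634624514, 634624514),
    (614214514, 634636514), (643541642, 643541642), (641541241, 643541663), (123121123, 133361123),
    (163161163, 163361163), (123122122, 133132122), (123121123, 133363123), (322322322, 333322322),
    (123132132, 123132132), (132132112, 133132336), (136136116, 136136316), (123177173, 323377173),
    (132137177, 332137377), (177177177, 177377377), (211213213, 231313213), (611211211, 631213213),
    (213211211, 633211211), (411611611, 633611611), (611613613, 631613613), (211231231, 213231331),
    (611231231, 613631631), (211233233, 211233333), (212213212, 312313212), (232232232, 232333232),
    (211213213, 233313213), (213233233, 213233333), (213333233, 213333233), (221221231, 321321231),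
    (221221331, 321221331), (223223223, 223223333), (211231231, 233231331), (233233223, 233233323),
    (321121321, 321363331), (361161361, 361163361), (377177177, 377177377), (231233233, 231233333),
    (233232233, 233333233), (211233233, 233233333), (277377377, 277377377), (617217717, 637237737),
    (671771271, 673773273), (312213312, 312213312), (312312112, 312313336), (316316116, 316316136),
    (377377177, 377377177), (317312717, 337312737), (717717717, 717737737), (737717717, 737717737),
    (737737717, 737737717), (322323323, 332323323), (322332332, 323332332), (322333333, 322333333),
    (323121323, 323361323), (323321333, 323361333), (323123323, 323163323), (323323223, 323323333),
    (323121323, 323363323), (123177173, 323377373), (333123323, 333163323), (322323323, 333323323),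
    (333333223, 333333223), (371771321, 373773323), (737727737, 737727737), (771771771, 771773773),
    (773771771, 773771773), (773773771, 773773771), (332232332, 332233332), (332332112, 332332336),
    (332333312, 332333316), (332232332, 332333332), (132137177, 332337377), (333232333, 333232333),
    (333332132, 333332136), (322332332, 333332332), (317312717, 337332737), (773773772, 773773772),
    (444444445, 444444465), (444444454, 444446455), (444444544, 446444544), (444444545, 444444545),
    (444444554, 444446555), (444544444, 444544555), (544444444, 564544555), (546544544, 566544555),
    (444445444, 544445645), (444445544, 546445544), (444454444, 544554444), (444454445, 444554465),
    (444454454, 444456455), (444454544, 546554544), (444444545, 444454545), (454444444, 454454545),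
    (444444454, 454456555), (454654454, 454656555), (544444444, 554454454), (445444444, 555454454),
    (444444445, 555444445), (444445444, 555445645), (445445465, 555445665), (454454454, 555656454),
    (455477477, 455677677), (555477477, 555477677), (555677477, 555677477), (774774554, 774776555),
    (776774554, 776774555), (776776554, 776776554), (444455444, 544455444), (445455444, 445455444),
    (444544444, 445555444), (444444445, 445555465), (445445645, 445555665), (544545444, 544545444),
    (444454444, 544555444), (444444544, 546555544), (564544544, 566555544), (747545747, 747555767),
    (767545747, 767545767), (767555747, 767555747), (777777777, 777777777)])
    (by decide +kernel) (by decide +kernel)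

theorem isLeast_root_4 : IsLeast (proofSizes (root 4)) 11 :=
  isLeast_proofSizes (cuts := 64523378931) (families := [
    (126444444, 126444444), (142444644, 142444644), (142444464, 142444664), (161444262, 161444262),
    (164444444, 164444444), (215444444, 215444444), (214544444, 215544444), (214454444, 215554444),
    (214445444, 215555444), (225115444, 225115444), (251444444, 251444444), (344444444, 344444444),
    (254444444, 354555444), (142444446, 142444666), (146444444, 346444666), (162444444, 166444664),
    (142444446, 166444666), (377444444, 377554666), (377555444, 377555666)])
    (by decide +kernel) (by decide +kernel)

theorem isLeast_root_5 : IsLeast (proofSizes (root 5)) 5 :=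
  isLeast_proofSizes (cuts := 15545) (families := [
    (214164444, 214164444), (444464444, 444464444), (464544444, 464564444), (524214444, 524214444),
    (544424444, 544424444), (544444444, 564544444), (144464444, 544464444), (774774444, 774774444)])
    (by decide +kernel) (by decide +kernel)

theorem isLeast_root_6 : IsLeast (proofSizes (root 6)) 3 :=
  isLeast_proofSizes (cuts := 125) (families := [
    (134624444, 134624444), (224234444, 224234444), (544444444, 544444444), (774674444, 774674444)])
    (by decide +kernel) (by decide +kernel)

theorem isLeast_root_7 : IsLeast (proofSizes (root 7)) 5 :=
  isLeast_proofSizes (cuts := 15545) (families := [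
    (211166166, 211166166), (444466466, 444466466), (522211211, 522211211), (544422422, 544422422),
    (544444444, 544444444), (144466466, 544466466), (466544544, 566544544), (466566566, 466566566),
    (777777777, 777777777)])
    (by decide +kernel) (by decide +kernel)

theorem isLeast_root_8 : IsLeast (proofSizes (root 8)) 3 :=
  isLeast_proofSizes (cuts := 125) (families := [
    (133623623, 133623623), (222233233, 222233233), (333622622, 333622622), (544444444, 544444444),
    (777677677, 777677677)])
    (by decide +kernel) (by decide +kernel)

theorem isLeast_root_9 : IsLeast (proofSizes (root 9)) 11 :=
  isLeast_proofSizes (cuts := 78931245245) (families := [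
    (112112464, 112112464), (112112446, 112112466), (221221544, 221221544), (314114444, 314114444),
    (324224444, 324224444), (134114444, 334114444), (234224444, 334224444), (114314444, 334314444),
    (224324444, 334324444), (114134444, 334134444), (114334444, 314334444), (116116444, 336316466),
    (116136444, 336136466), (116336444, 316336466), (134334444, 134334444), (224234444, 334334444),
    (225225444, 335335544), (116116444, 336336466), (337337564, 337337564), (337337546, 337337566)])
    (by decide +kernel) (by decide +kernel)

theorem isLeast_root_10 : IsLeast (proofSizes (root 10)) 3 :=
  isLeast_proofSizes (cuts := 132) (families := [
    (115136666, 115136666), (136354666, 136354666), (262555253, 262555253), (333333213, 333333213),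
    (336514646, 336514646), (353554642, 353554642), (554554444, 554554444), (646444646, 646444646),
    (776754666, 776754666), (777777677, 777777677)])
    (by decide +kernel) (by decide +kernel)

theorem isLeast_root_11 : IsLeast (proofSizes (root 11)) 3 :=
  isLeast_proofSizes (cuts := 139) (families := [
    (113113662, 113113662), (222222223, 222222223), (331331535, 331331535), (333333114, 333333114),
    (333333777, 333333777)])
    (by decide +kernel) (by decide +kernel)

theorem isLeast_root_12 : IsLeast (proofSizes (root 12)) 17 :=
  isLeast_proofSizes (cuts := 12345678923456789) (families := [
    (111111111, 333333333), (222222222, 333333333)])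
    (by decide +kernel) (by decide +kernel)

theorem isLeast_root (σ : Fin 13) : IsLeast (proofSizes (root σ)) (nuMin σ) :=
  match σ with
  | 0 => isLeast_root_0
  | 1 => isLeast_root_1
  | 2 => isLeast_root_2
  | 3 => isLeast_root_3
  | 4 => isLeast_root_4
  | 5 => isLeast_root_5
  | 6 => isLeast_root_6
  | 7 => isLeast_root_7
  | 8 => isLeast_root_8
  | 9 => isLeast_root_9
  | 10 => isLeast_root_10
  | 11 => isLeast_root_11
  | 12 => isLeast_root_12

end Packed

end NilpotentCuts

/-! ### Minimal sizes, their sum, and an optimal score -/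

theorem mainTheorem1 :
    (∀ σ : Fin 13, IsLeast (NilpotentCuts.proofSizes (NilpotentCuts.root σ))
      (NilpotentCuts.nuMin σ)) ∧
    IsLeast {n : ℕ | ∃ T : (σ : Fin 13) → NilpotentCuts.ProofTree (NilpotentCuts.root σ),
      (∀ σ, (T σ).Complete) ∧ ∑ σ, (T σ).numPassive = n} 151 ∧
    ∃ N₂ : NilpotentCuts.Position 3 2 → Fin 3 → Fin 3 → ℝ, ∀ σ : Fin 13,
      (∃ T : NilpotentCuts.ProofTree (NilpotentCuts.root σ), T.Complete ∧ T.Follows N₂) ∧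
      ∀ T : NilpotentCuts.ProofTree (NilpotentCuts.root σ), T.Complete → T.Follows N₂ →
        T.numPassive = NilpotentCuts.nuMin σ := by
  have h := NilpotentCuts.Packed.isLeast_root
  have hsum : ∑ σ, NilpotentCuts.nuMin σ = 151 := by decide
  refine ⟨h, ⟨?_, ?_⟩, NilpotentCuts.optimalScore, fun σ =>
    ⟨NilpotentCuts.exists_follows _, fun T hT hF => ?_⟩⟩
  · choose T hT hn using fun σ => (h σ).1
    exact ⟨T, hT, by simp only [hn, hsum]⟩
  · rintro _ ⟨T, hT, rfl⟩
    rw [← hsum]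
    exact Finset.sum_le_sum fun σ _ => (h σ).2 ⟨T σ, hT σ, rfl⟩
  · exact (NilpotentCuts.numPassive_of_follows T hT hF).trans (h σ).csInf_eq
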